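/- Let $k$ be a field with $\operatorname{char} k \neq 2$, and let $R=\bigoplus_{i\ge 0}R_i$ be a commutative Noetherian positively graded $k$-algebra with $R_0=k$. Let $M=\bigoplus_{i\in\mathbb Z}M_i$ be a finitely generated graded $R$-module such that $\operatorname{Tor}_i^R(M,M)=0$ for every $i>0$. For a graded $R$-module $N$ write $H_N(t)=\sum_{i\in\mathbb Z}(\dim_k N_i)\,t^i$ for its Hilbert series. Let $S^2_R(M)=(M\otimes_R M)/\langle x\otimes y-y\otimes x : x,y\in M\rangle$ be the second symmetric power of $M$ and $\bigwedge^2_R(M)$ its second exterior power, each graded so that the product of homogeneous elements of degrees $i$ and $j$ has degree $i+j$. Then the graded components of $R$, $M$, $S^2_R(M)$ and $\bigwedge^2_R(M)$ are finite-dimensional over $k$ and vanish in all sufficiently negative degrees (so that their Hilbert series are formal Laurent series), and in the field $\mathbb Q((t))$ of formal Laurent series $$H_{S^2_R(M)}(t)=\frac{H_M(t)^2}{2H_R(t)}+\frac{H_M(t^2)\,H_R(t)}{2H_R(t^2)}\qquad\text{and}\qquad H_{\bigwedge^2_R(M)}(t)=\frac{H_M(t)^2}{2H_R(t)}-\frac{H_R(t)\,H_M(t^2)}{2H_R(t^2)}.$$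 -/

import Mathlib

open scoped TensorProduct
open CategoryTheory

universe u

noncomputable section

/-- A `ℤ`-indexed grading `𝒜` of a `k`-algebra `R` is positive when it is concentrated in
nonnegative degrees and `R₀ = k`, that is, the structure map is a bijection from `k` to `𝒜 0`. -/
structure IsPositivelyGraded {k R : Type*} [Field k] [CommRing R] [Algebra k R]
    (𝒜 : ℤ → Submodule k R) : Prop where
  eq_bot_of_neg : ∀ i < 0, 𝒜 i = ⊥
  injective_algebraMap : Function.Injective (algebraMap k R)
  range_algebraMap : Set.range (algebraMap k R) = 𝒜 0

section Hilbert

variable {k V : Type*} [Field k] [AddCommGroup V] [Module k V]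

/-- The family `ℳ` of vector spaces has a Hilbert series in the ring of formal Laurent series:
every component is finite dimensional, and the components vanish in all sufficiently negative
degrees. -/
structure HasHilbertSeries (ℳ : ℤ → Submodule k V) : Prop where
  finite : ∀ i, FiniteDimensional k (ℳ i)
  bddBelow : BddBelow {i : ℤ | ℳ i ≠ ⊥}

open Classical in
/-- The Hilbert series `∑ i, (dim_k ℳ i) t ^ i`, as a formal Laurent series with rational
coefficients. It is meaningful when `HasHilbertSeries ℳ` holds; it is set to `0` when the dimension
function is not supported on a set that is bounded below. -/
def hilbertSeries (ℳ : ℤ → Submodule k V) : LaurentSeries ℚ :=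
  if h : BddBelow (Function.support fun i : ℤ => (Module.finrank k (ℳ i) : ℚ)) then
    HahnSeries.ofSuppBddBelow (fun i : ℤ => (Module.finrank k (ℳ i) : ℚ)) h
  else 0

end Hilbert

/-- The substitution `f(t) ↦ f(t ^ 2)` on formal Laurent series. -/
def substSq : LaurentSeries ℚ →+* LaurentSeries ℚ :=
  HahnSeries.embDomainRingHom (AddMonoidHom.mulLeft (2 : ℤ))
    (fun a b h => by simpa using h) (fun a b => by simp)

section Squares

variable (R M : Type*) [CommRing R] [AddCommGroup M] [Module R M]

/-- The submodule of `M ⊗ M` generated by all `x ⊗ y - y ⊗ x`. -/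
def symSqRel : Submodule R (M ⊗[R] M) :=
  Submodule.span R {z | ∃ x y : M, z = x ⊗ₜ[R] y - y ⊗ₜ[R] x}

/-- The second symmetric power `S²_R(M)`. -/
abbrev SymSq : Type _ := (M ⊗[R] M) ⧸ symSqRel R M

variable {k : Type*} {M} [Field k] [Algebra k R] [Module k M] [IsScalarTower k R M]

/-- The degree `n` component of `S²_R(M)`, for a grading `ℳ` of `M`: it is spanned over `k` by the
products `x y` of homogeneous elements with `deg x + deg y = n`. -/
def symSqGrading (ℳ : ℤ → Submodule k M) (n : ℤ) : Submodule k (SymSq R M) :=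
  Submodule.span k {z | ∃ i j : ℤ, i + j = n ∧ ∃ x ∈ ℳ i, ∃ y ∈ ℳ j,
    z = (symSqRel R M).mkQ (x ⊗ₜ[R] y)}

/-- The degree `n` component of the second exterior power `⋀²_R(M)`, for a grading `ℳ` of `M`: it
is spanned over `k` by the `x ∧ y` with `x`, `y` homogeneous and `deg x + deg y = n`. -/
def extSqGrading (ℳ : ℤ → Submodule k M) (n : ℤ) : Submodule k (⋀[R]^2 M) :=
  Submodule.span k {z | ∃ i j : ℤ, i + j = n ∧ ∃ x ∈ ℳ i, ∃ y ∈ ℳ j,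
    z = exteriorPower.ιMulti R 2 ![x, y]}

end Squares

end

/-! Since 2 is invertible in `k`, the exchange of factors splits `M ⊗ M` into eigenspaces `(M ⊗
M)^ε`, `ε = ±1`, whose graded dimensions are those of `S² M` and `⋀² M`. The two formulas are
therefore equivalent to one for the sum and one for the difference of the two eigenspace series:
`H_M(t)² / H_R(t)` and `H_R(t) H_M(t²) / H_R(t²)`. With denominators cleared, the errors in these
are `tensorDefect` and `traceDefect`, and the task is to show that both are zero.

Let `f : F → M` be a graded free cover with kernel `K`. Tor-independence makes the sequence `0 → (K
⊗ K)^(-ε) → K ⊗ F → (F ⊗ F)^ε → (M ⊗ M)^ε → 0` exact, with middle map `x ⊗ y ↦ x ⊗ y + ε • y ⊗ x`;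
its Euler characteristic is `finrank_swapGrading_add`. The terms with `F` are explicit: `F ⊗ F` is a
space of matrices, where symmetric exceeds antisymmetric by the diagonal. Because the sign `ε` flips
along the sequence, passing from `M` to `K` preserves the first defect and negates the second
(`defects_ker`).

The kernel `K` is again Tor-independent of itself, and a cover that is minimal in the lowest degree
of `M` makes `K` start strictly higher (`exists_free_cover`). The defects of a module starting in
degree `m` vanish below degree `2 * m`, so after finitely many syzygies any given coefficient is
seen to be zero (`defects_eq_zero`). No finite resolution is needed.

Tor enters only through the injectivity of syzygy inclusions after tensoring. `TorIndep` records
this in a form for which symmetry and dimension shifting are elementary. -/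

set_option linter.unusedSectionVars false

/-! ### Projections onto homogeneous components -/

section GradedProj

variable {k V W : Type*} [Field k] [AddCommGroup V] [Module k V] [AddCommGroup W] [Module k W]

/-- The projection of a graded vector space onto its degree `n` component. -/
noncomputable def gradedProj (𝒱 : ℤ → Submodule k V) [DirectSum.Decomposition 𝒱] (n : ℤ) :
    V →ₗ[k] V :=
  (𝒱 n).subtype ∘ₗ DirectSum.component k ℤ (fun i => 𝒱 i) n ∘ₗ
    (DirectSum.decomposeLinearEquiv 𝒱).toLinearMap

variable (𝒱 : ℤ → Submodule k V) [DirectSum.Decomposition 𝒱]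
  (𝒲 : ℤ → Submodule k W) [DirectSum.Decomposition 𝒲]

theorem gradedProj_mem (n : ℤ) (v : V) : gradedProj 𝒱 n v ∈ 𝒱 n :=
  (DirectSum.decompose 𝒱 v n).2

variable {𝒱} in
theorem gradedProj_of_mem {n : ℤ} {v : V} (hv : v ∈ 𝒱 n) : gradedProj 𝒱 n v = v :=
  DirectSum.decompose_of_mem_same 𝒱 hv

variable {𝒱} in
theorem gradedProj_of_mem_ne {m n : ℤ} {v : V} (hv : v ∈ 𝒱 n) (h : n ≠ m) :
    gradedProj 𝒱 m v = 0 :=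
  DirectSum.decompose_of_mem_ne 𝒱 hv h

theorem mem_iSup_of_decomposition (v : V) : v ∈ ⨆ n, 𝒱 n := by
  rw [(DirectSum.Decomposition.isInternal 𝒱).submodule_iSup_eq_top]
  trivial

variable {𝒱 𝒲} in
theorem gradedProj_map {F : Type*} [FunLike F V W] [AddMonoidHomClass F V W] (f : F)
    (hf : ∀ n, ∀ v ∈ 𝒱 n, f v ∈ 𝒲 n) (n : ℤ) (v : V) :
    gradedProj 𝒲 n (f v) = f (gradedProj 𝒱 n v) := by
  induction v using DirectSum.Decomposition.inductionOn 𝒱 with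
  | zero => simp
  | @homogeneous i v =>
    by_cases h : i = n
    · subst h
      rw [gradedProj_of_mem v.2, gradedProj_of_mem (hf _ _ v.2)]
    · rw [gradedProj_of_mem_ne v.2 h, gradedProj_of_mem_ne (hf _ _ v.2) h, map_zero]
  | add v w hv hw => simp only [map_add, hv, hw]

variable {𝒱 𝒲} in
/-- A homogeneous element in the range of a graded map is the image of a homogeneous element. -/
theorem exists_mem_of_mem_range {F : Type*} [FunLike F V W] [AddMonoidHomClass F V W] (f : F)
    (hf : ∀ n, ∀ v ∈ 𝒱 n, f v ∈ 𝒲 n) {n : ℤ} {w : W} (hw : w ∈ 𝒲 n) (h : ∃ v, f v = w) :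
    ∃ v ∈ 𝒱 n, f v = w := by
  obtain ⟨v, rfl⟩ := h
  exact ⟨gradedProj 𝒱 n v, gradedProj_mem 𝒱 n v, by
    rw [← gradedProj_map f hf, gradedProj_of_mem hw]⟩

/-- A family of subspaces spanning `V` is a grading as soon as it admits projections. -/
theorem isInternal_of_projections {𝒰 : ℤ → Submodule k V} (p : ℤ → V →ₗ[k] V)
    (hp : ∀ n, ∀ v ∈ 𝒰 n, p n v = v) (hp' : ∀ m n, n ≠ m → ∀ v ∈ 𝒰 n, p m v = 0)
    (htop : ∀ v, v ∈ ⨆ n, 𝒰 n) : DirectSum.IsInternal 𝒰 := by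
  refine DirectSum.isInternal_submodule_of_iSupIndep_of_iSup_eq_top ?_
    (eq_top_iff.2 fun v _ => htop v)
  intro n
  rw [Submodule.disjoint_def]
  intro v hv hv'
  have hle : (⨆ (j) (_ : j ≠ n), 𝒰 j) ≤ LinearMap.ker (p n) :=
    iSup₂_le fun j hj w hw => hp' n j hj w hw
  rw [← hp n v hv]
  exact hle hv'

end GradedProj

/-! ### Gradings on submodules and kernels -/

section KernelGrading

variable {k R F M : Type*} [Field k] [CommRing R] [Algebra k R]
  [AddCommGroup F] [Module R F] [Module k F] [IsScalarTower k R F]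

/-- The grading induced on a submodule. -/
def subGrading (K : Submodule R F) (ℱ : ℤ → Submodule k F) (n : ℤ) : Submodule k K :=
  (ℱ n).comap (K.subtype.restrictScalars k)

theorem mem_subGrading {K : Submodule R F} {ℱ : ℤ → Submodule k F} {n : ℤ} {x : K} :
    x ∈ subGrading K ℱ n ↔ (x : F) ∈ ℱ n := Iff.rfl

theorem subGrading_isInternal {K : Submodule R F} (ℱ : ℤ → Submodule k F)
    [DirectSum.Decomposition ℱ] (hK : ∀ n, ∀ x ∈ K, gradedProj ℱ n x ∈ K) :
    DirectSum.IsInternal (subGrading K ℱ) := by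
  classical
  refine isInternal_of_projections
    (fun n => ((gradedProj ℱ n).restrict (p := K.restrictScalars k) (q := K.restrictScalars k)
      (fun x hx => hK n x hx) : K.restrictScalars k →ₗ[k] K.restrictScalars k)) ?_ ?_ ?_
  · intro n v hv
    exact Subtype.ext (gradedProj_of_mem hv)
  · intro m n h v hv
    exact Subtype.ext (gradedProj_of_mem_ne hv h)
  · intro v
    have hs := DirectSum.sum_support_decompose ℱ (v : F)
    have : v = ∑ i ∈ (DirectSum.decompose ℱ (v : F)).support,
        (⟨gradedProj ℱ i v, hK i v v.2⟩ : K) := by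
      apply Subtype.ext
      rw [AddSubmonoidClass.coe_finsetSum]
      exact hs.symm
    rw [this]
    refine Submodule.sum_mem _ fun i _ => Submodule.mem_iSup_of_mem i ?_
    exact gradedProj_mem ℱ i _

theorem subGrading_gradedSMul (𝒜 : ℤ → Submodule k R) (K : Submodule R F)
    (ℱ : ℤ → Submodule k F) [SetLike.GradedSMul 𝒜 ℱ] :
    SetLike.GradedSMul 𝒜 (subGrading K ℱ) where
  smul_mem := fun {i j a x} ha hx => by
    have := SetLike.GradedSMul.smul_mem (A := 𝒜) (B := ℱ) ha hx
    exact this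

variable [AddCommGroup M] [Module R M] [Module k M] [IsScalarTower k R M]

theorem ker_gradedProj_mem {ℱ : ℤ → Submodule k F} [DirectSum.Decomposition ℱ]
    {ℳ : ℤ → Submodule k M} [DirectSum.Decomposition ℳ] (g : F →ₗ[R] M)
    (hg : ∀ n, ∀ v ∈ ℱ n, g v ∈ ℳ n) (n : ℤ) (x : F) (hx : x ∈ LinearMap.ker g) :
    gradedProj ℱ n x ∈ LinearMap.ker g := by
  rw [LinearMap.mem_ker, ← gradedProj_map g hg, LinearMap.mem_ker.1 hx, map_zero]

end KernelGrading

/-! ### Graded free modules with shifted generators -/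

section FreeGrading

variable {k R ι : Type*} [Field k] [CommRing R] [Algebra k R]

/-- The grading of the free module `ι → R` whose `j`-th basis vector has degree `d j`. -/
def freeGrading (𝒜 : ℤ → Submodule k R) (d : ι → ℤ) (n : ℤ) : Submodule k (ι → R) :=
  Submodule.pi Set.univ fun j => 𝒜 (n - d j)

theorem mem_freeGrading {𝒜 : ℤ → Submodule k R} {d : ι → ℤ} {n : ℤ} {v : ι → R} :
    v ∈ freeGrading 𝒜 d n ↔ ∀ j, v j ∈ 𝒜 (n - d j) := by
  simp [freeGrading, Submodule.mem_pi]

theorem single_mem_freeGrading [DecidableEq ι] {𝒜 : ℤ → Submodule k R} {d : ι → ℤ} {n : ℤ} (j : ι)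
    {a : R} (ha : a ∈ 𝒜 n) : Pi.single j a ∈ freeGrading 𝒜 d (n + d j) := by
  rw [mem_freeGrading]
  intro l
  by_cases h : l = j
  · subst h; simpa using ha
  · simp [h]

theorem freeGrading_isInternal [Fintype ι] (𝒜 : ℤ → Submodule k R) [GradedAlgebra 𝒜] (d : ι → ℤ) :
    DirectSum.IsInternal (freeGrading 𝒜 d) := by
  classical
  refine isInternal_of_projections
    (fun n => LinearMap.pi fun j => gradedProj 𝒜 (n - d j) ∘ₗ LinearMap.proj j) ?_ ?_ ?_
  · intro n v hv
    funext j
    exact gradedProj_of_mem (mem_freeGrading.1 hv j)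
  · intro m n h v hv
    funext j
    exact gradedProj_of_mem_ne (mem_freeGrading.1 hv j) (by simpa using h)
  · intro v
    rw [← Finset.univ_sum_single v]
    refine Submodule.sum_mem _ fun j _ => ?_
    have h := mem_iSup_of_decomposition 𝒜 (v j)
    refine (iSup_le fun n => ?_ : (⨆ n, 𝒜 n) ≤
      (⨆ n, freeGrading 𝒜 d n).comap (LinearMap.single k (fun _ => R) j)) h
    intro a ha
    exact Submodule.mem_iSup_of_mem (n + d j) (single_mem_freeGrading j ha)

theorem freeGrading_gradedSMul (𝒜 : ℤ → Submodule k R) [GradedAlgebra 𝒜] (d : ι → ℤ) :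
    SetLike.GradedSMul 𝒜 (freeGrading 𝒜 d) where
  smul_mem := fun {i j a v} ha hv => by
    rw [mem_freeGrading] at hv ⊢
    intro l
    have := SetLike.GradedMul.mul_mem ha (hv l)
    rwa [← add_sub_assoc] at this

variable {M : Type*} [AddCommGroup M] [Module R M] [Module k M] [IsScalarTower k R M]

theorem linearCombination_mem [Fintype ι] {𝒜 : ℤ → Submodule k R} {ℳ : ℤ → Submodule k M}
    [SetLike.GradedSMul 𝒜 ℳ] {d : ι → ℤ} {y : ι → M} (hy : ∀ j, y j ∈ ℳ (d j)) (n : ℤ)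
    (v : ι → R) (hv : v ∈ freeGrading 𝒜 d n) : Fintype.linearCombination R y v ∈ ℳ n := by
  rw [Fintype.linearCombination_apply]
  refine Submodule.sum_mem _ fun j _ => ?_
  have := SetLike.GradedSMul.smul_mem (A := 𝒜) (B := ℳ) (mem_freeGrading.1 hv j) (hy j)
  simpa using this

end FreeGrading

/-! ### The grading of a tensor product over `R` -/

section TensorGrading

variable {k R M N : Type*} [Field k] [CommRing R] [Algebra k R]
  [AddCommGroup M] [Module R M] [Module k M] [IsScalarTower k R M]
  [AddCommGroup N] [Module R N] [Module k N] [IsScalarTower k R N]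

variable (R) in
/-- The degree `n` component of the tensor product of two graded modules. -/
def tensorGrading (ℳ : ℤ → Submodule k M) (𝒩 : ℤ → Submodule k N) (n : ℤ) :
    Submodule k (M ⊗[R] N) :=
  Submodule.span k {z | ∃ i j : ℤ, i + j = n ∧ ∃ x ∈ ℳ i, ∃ y ∈ 𝒩 j, z = x ⊗ₜ[R] y}

theorem tmul_mem_tensorGrading {ℳ : ℤ → Submodule k M} {𝒩 : ℤ → Submodule k N} {i j : ℤ} {x : M}
    {y : N} (hx : x ∈ ℳ i) (hy : y ∈ 𝒩 j) : x ⊗ₜ[R] y ∈ tensorGrading R ℳ 𝒩 (i + j) :=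
  Submodule.subset_span ⟨i, j, rfl, x, hx, y, hy, rfl⟩

/-- Induction principle for homogeneous additive statements on a tensor product. -/
theorem tensorGrading_le {ℳ : ℤ → Submodule k M} {𝒩 : ℤ → Submodule k N} {n : ℤ}
    {P : Submodule k (M ⊗[R] N)}
    (h : ∀ i j, i + j = n → ∀ x ∈ ℳ i, ∀ y ∈ 𝒩 j, x ⊗ₜ[R] y ∈ P) : tensorGrading R ℳ 𝒩 n ≤ P := by
  refine Submodule.span_le.2 ?_
  rintro _ ⟨i, j, hij, x, hx, y, hy, rfl⟩
  exact h i j hij x hx y hy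

variable (ℳ : ℤ → Submodule k M) [DirectSum.Decomposition ℳ]
  (𝒩 : ℤ → Submodule k N) [DirectSum.Decomposition 𝒩]

variable (R) in
/-- The bilinear map `(x, y) ↦ ∑ x i ⊗ y j` over `i + j = n`. -/
noncomputable def tensorProjAux (n : ℤ) : M →ₗ[k] N →ₗ[k] M ⊗[R] N :=
  DirectSum.toModule k ℤ _ (fun i =>
    LinearMap.mk₂ k (fun (x : ℳ i) (y : N) => (x : M) ⊗ₜ[R] gradedProj 𝒩 (n - i) y)
      (fun x x' y => by simp [TensorProduct.add_tmul])
      (fun c x y => by simp [TensorProduct.smul_tmul'])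
      (fun x y y' => by simp [TensorProduct.tmul_add])
      (fun c x y => by
        rw [map_smul, ← algebraMap_smul R c (gradedProj 𝒩 (n - i) y), TensorProduct.tmul_smul,
          algebraMap_smul])) ∘ₗ
    (DirectSum.decomposeLinearEquiv ℳ).toLinearMap

theorem tensorProjAux_of_mem {n i : ℤ} {x : M} (hx : x ∈ ℳ i) (y : N) :
    tensorProjAux R ℳ 𝒩 n x y = x ⊗ₜ[R] gradedProj 𝒩 (n - i) y := by
  have h : DirectSum.decomposeLinearEquiv ℳ x = DirectSum.lof k ℤ (fun i => ℳ i) i ⟨x, hx⟩ :=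
    DirectSum.decompose_of_mem ℳ hx
  rw [tensorProjAux, LinearMap.comp_apply, LinearEquiv.coe_coe, h, DirectSum.toModule_lof]
  rfl

theorem gradedProj_smul (𝒜 : ℤ → Submodule k R) [SetLike.GradedSMul 𝒜 𝒩] {i : ℤ} {a : R} (ha : a ∈ 𝒜 i) (n : ℤ) (y : N) :
    gradedProj 𝒩 (i + n) (a • y) = a • gradedProj 𝒩 n y := by
  induction y using DirectSum.Decomposition.inductionOn 𝒩 with
  | zero => simp
  | @homogeneous j y =>
    have hay : a • (y : N) ∈ 𝒩 (i + j) := SetLike.GradedSMul.smul_mem (A := 𝒜) (B := 𝒩) ha y.2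
    by_cases h : j = n
    · subst h
      rw [gradedProj_of_mem y.2, gradedProj_of_mem hay]
    · rw [gradedProj_of_mem_ne y.2 h, gradedProj_of_mem_ne hay (by simpa using h), smul_zero]
  | add v w hv hw => simp only [map_add, smul_add, hv, hw]

/-- This balancing is what lets the `k`-bilinear projection descend to the tensor product over `R`.
For homogeneous `a` and `x`, the degree shift of `a • x` on the left matches that of `a • y` on the
right. -/
theorem tensorProjAux_smul (𝒜 : ℤ → Submodule k R) [GradedAlgebra 𝒜] [SetLike.GradedSMul 𝒜 ℳ]
    [SetLike.GradedSMul 𝒜 𝒩] (n : ℤ) (a : R) (x : M) (y : N) :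
    tensorProjAux R ℳ 𝒩 n (a • x) y = tensorProjAux R ℳ 𝒩 n x (a • y) := by
  induction a using DirectSum.Decomposition.inductionOn 𝒜 with
  | zero => simp
  | add a b ha hb => simp only [add_smul, map_add, LinearMap.add_apply, ha, hb]
  | @homogeneous i a =>
    induction x using DirectSum.Decomposition.inductionOn ℳ with
    | zero => simp
    | add v w hv hw => simp only [map_add, smul_add, LinearMap.add_apply, hv, hw]
    | @homogeneous j x =>
      have hax : (a : R) • (x : M) ∈ ℳ (i + j) :=
        SetLike.GradedSMul.smul_mem (A := 𝒜) (B := ℳ) a.2 x.2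
      rw [tensorProjAux_of_mem ℳ 𝒩 hax, tensorProjAux_of_mem ℳ 𝒩 x.2, TensorProduct.smul_tmul,
        ← gradedProj_smul 𝒩 𝒜 a.2]
      congr 3
      ring

theorem tensorGrading_isInternal (𝒜 : ℤ → Submodule k R) [GradedAlgebra 𝒜] [SetLike.GradedSMul 𝒜 ℳ]
    [SetLike.GradedSMul 𝒜 𝒩] :
    DirectSum.IsInternal (tensorGrading R ℳ 𝒩) := by
  have hp : ∀ n : ℤ, ∃ p : M ⊗[R] N →ₗ[k] M ⊗[R] N, ∀ x y,
      p (x ⊗ₜ[R] y) = tensorProjAux R ℳ 𝒩 n x y := by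
    intro n
    -- The projection is balanced over `R` but not `R`-linear, so it is lifted as an additive map
    -- and its `k`-linearity is checked afterwards.
    let q : M ⊗[R] N →+ M ⊗[R] N := TensorProduct.liftAddHom
      (AddMonoidHom.mk' (fun x => (tensorProjAux R ℳ 𝒩 n x).toAddMonoidHom)
        (fun x x' => by ext y; simp))
      (fun a x y => tensorProjAux_smul ℳ 𝒩 𝒜 n a x y)
    refine ⟨{ q with map_smul' := fun c z => ?_ }, fun x y => rfl⟩
    change q (c • z) = c • q z
    induction z using TensorProduct.induction_on with
    | zero => simp
    | add x y hx hy => simp only [smul_add, map_add, hx, hy]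
    | tmul x y =>
      rw [TensorProduct.smul_tmul']
      change tensorProjAux R ℳ 𝒩 n (c • x) y = c • tensorProjAux R ℳ 𝒩 n x y
      rw [map_smul, LinearMap.smul_apply]
  choose p hp using hp
  refine isInternal_of_projections p ?_ ?_ ?_
  · intro n v hv
    have : tensorGrading R ℳ 𝒩 n ≤ LinearMap.ker (p n - LinearMap.id) := by
      refine tensorGrading_le fun i j hij x hx y hy => ?_
      rw [LinearMap.mem_ker, LinearMap.sub_apply, hp, tensorProjAux_of_mem ℳ 𝒩 hx,
        show n - i = j by omega, gradedProj_of_mem hy, LinearMap.id_apply, sub_self]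
    exact sub_eq_zero.1 (this hv)
  · intro m n hmn v hv
    have : tensorGrading R ℳ 𝒩 n ≤ LinearMap.ker (p m) := by
      refine tensorGrading_le fun i j hij x hx y hy => ?_
      rw [LinearMap.mem_ker, hp, tensorProjAux_of_mem ℳ 𝒩 hx,
        gradedProj_of_mem_ne hy (by omega), TensorProduct.tmul_zero]
    exact this hv
  · intro v
    induction v using TensorProduct.induction_on with
    | zero => exact zero_mem _
    | add x y hx hy => exact add_mem hx hy
    | tmul x y =>
      induction x using DirectSum.Decomposition.inductionOn ℳ with
      | zero => simp
      | add v w hv hw => rw [TensorProduct.add_tmul]; exact add_mem hv hw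
      | @homogeneous i x =>
        induction y using DirectSum.Decomposition.inductionOn 𝒩 with
        | zero => simp
        | add v w hv hw => rw [TensorProduct.tmul_add]; exact add_mem hv hw
        | @homogeneous j y =>
          exact Submodule.mem_iSup_of_mem (i + j) (tmul_mem_tensorGrading x.2 y.2)

end TensorGrading

/-! ### Tor-independence: symmetry and dimension shifting -/

section TorIndependence

variable {R : Type u} [CommRing R]

/-- Tor-independence of `A` and `B` up to order `n`: there is a partial flat resolution of `B` of
length `n` whose syzygies stay submodules after tensoring with `A`. -/
def TorIndepUpTo (A : Type u) [AddCommGroup A] [Module R A] :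
    ℕ → ∀ (B : Type u) [AddCommGroup B] [Module R B], Prop
  | 0, _, _, _ => True
  | n + 1, B, _, _ => ∃ (F : Type u) (_ : AddCommGroup F) (_ : Module R F) (g : F →ₗ[R] B),
      Module.Flat R F ∧ Function.Surjective g ∧
        Function.Injective ((LinearMap.ker g).subtype.lTensor A) ∧
        TorIndepUpTo A n (LinearMap.ker g)

variable (R) in
/-- Tor-independence of `A` and `B`: the vanishing of `Tor i A B` for all `i > 0`. -/
def TorIndep (A B : Type u) [AddCommGroup A] [Module R A] [AddCommGroup B] [Module R B] : Prop :=
  ∀ n, TorIndepUpTo (R := R) A n B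

/-- The successive syzygies of the resolution serve as witnesses. An element of `A ⊗ ker g` that
dies in `A ⊗ P j` lifts to a cycle in `A ⊗ P (j + 1)`, hence to a boundary, and boundaries vanish in
`A ⊗ ker g`. -/
theorem torIndepUpTo_of_resolution (A : Type u) [AddCommGroup A] [Module R A]
    (P : ℕ → Type u) [∀ n, AddCommGroup (P n)] [∀ n, Module R (P n)] [∀ n, Module.Flat R (P n)]
    (d : ∀ n, P (n + 1) →ₗ[R] P n) (hd : ∀ n, Function.Exact (d (n + 1)) (d n))
    (hA : ∀ n, Function.Exact ((d (n + 1)).lTensor A) ((d n).lTensor A)) (n : ℕ) :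
    ∀ (j : ℕ) (B : Type u) [AddCommGroup B] [Module R B] (g : P j →ₗ[R] B),
      Function.Surjective g → Function.Exact (d j) g → TorIndepUpTo (R := R) A n B := by
  induction n with
  | zero => intros; trivial
  | succ n ih =>
    intro j B _ _ g hg hdg
    let d' : P (j + 1) →ₗ[R] LinearMap.ker g :=
      (d j).codRestrict (LinearMap.ker g) fun x => hdg.apply_apply_eq_zero x
    have hd' : Function.Surjective d' := by
      rintro ⟨x, hx⟩
      obtain ⟨y, rfl⟩ := (hdg x).1 hx
      exact ⟨y, rfl⟩
    have hex : Function.Exact (d (j + 1)) d' := by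
      intro x
      rw [← hd j x]
      exact Subtype.ext_iff
    refine ⟨P j, _, _, g, inferInstance, hg, ?_, ih (j + 1) _ d' hd' hex⟩
    rw [injective_iff_map_eq_zero]
    intro z hz
    obtain ⟨y, rfl⟩ := LinearMap.lTensor_surjective A hd' z
    rw [← LinearMap.comp_apply, ← LinearMap.lTensor_comp] at hz
    obtain ⟨x, rfl⟩ := (hA j y).1 hz
    rw [← LinearMap.comp_apply, ← LinearMap.lTensor_comp, hex.linearMap_comp_eq_zero]
    simp

/-- The snake argument: if `A` and `B` are Tor-independent, then the inclusion of a syzygy of `A`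
stays injective after tensoring with `B`. -/
theorem injective_rTensor_of_injective_lTensor {A B F G : Type u} [AddCommGroup A] [Module R A]
    [AddCommGroup B] [Module R B] [AddCommGroup F] [Module R F] [AddCommGroup G] [Module R G]
    [Module.Flat R G] (f : F →ₗ[R] A) (hf : Function.Surjective f)
    (g : G →ₗ[R] B) (hg : Function.Surjective g)
    (h : Function.Injective ((LinearMap.ker g).subtype.lTensor A)) :
    Function.Injective ((LinearMap.ker f).subtype.rTensor B) := by
  set K := LinearMap.ker f
  set L := LinearMap.ker g
  rw [injective_iff_map_eq_zero]
  intro z hz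
  obtain ⟨y, rfl⟩ := LinearMap.lTensor_surjective K hg z
  -- `y ∈ K ⊗ G` maps to `F ⊗ L` inside `F ⊗ G`
  have hexF : Function.Exact (L.subtype.lTensor F) (g.lTensor F) :=
    lTensor_exact F (LinearMap.exact_subtype_ker_map g) hg
  have hexK : Function.Exact (L.subtype.lTensor K) (g.lTensor K) :=
    lTensor_exact K (LinearMap.exact_subtype_ker_map g) hg
  have hexL : Function.Exact (K.subtype.rTensor L) (f.rTensor L) :=
    rTensor_exact L (LinearMap.exact_subtype_ker_map f) hf
  have hy : g.lTensor F (K.subtype.rTensor G y) = 0 := by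
    rw [← hz, ← LinearMap.comp_apply, ← LinearMap.comp_apply, LinearMap.lTensor_comp_rTensor,
      LinearMap.rTensor_comp_lTensor]
  obtain ⟨x, hx⟩ := (hexF _).1 hy
  have hx0 : f.rTensor L x = 0 := by
    apply h
    rw [map_zero, ← LinearMap.comp_apply, LinearMap.lTensor_comp_rTensor,
      ← LinearMap.rTensor_comp_lTensor, LinearMap.comp_apply, hx, ← LinearMap.comp_apply,
      ← LinearMap.rTensor_comp, (LinearMap.exact_subtype_ker_map f).linearMap_comp_eq_zero]
    simp
  obtain ⟨w, rfl⟩ := (hexL _).1 hx0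
  -- Flatness of `G` allows the comparison to be made in `F ⊗ G`. Then `y` comes from `K ⊗ L`, so it
  -- dies in `K ⊗ B`.
  have hyw : y = L.subtype.lTensor K w := by
    apply Module.Flat.rTensor_preserves_injective_linearMap (M := G) K.subtype K.subtype_injective
    rw [← hx, ← LinearMap.comp_apply, ← LinearMap.comp_apply, LinearMap.lTensor_comp_rTensor,
      LinearMap.rTensor_comp_lTensor]
  rw [hyw]
  exact hexK.apply_apply_eq_zero w

/-- Dimension shifting in the first variable, at the cost of one order. With `L = ker g`, the snake
argument applied to the next syzygy of `B` gives `K ⊗ L ↪ F ⊗ L`, and flatness gives `F ⊗ L ↪ F ⊗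
G`. The composite factors through `K ⊗ L → K ⊗ G`, which is therefore injective. -/
theorem TorIndepUpTo.ker {A F : Type u} [AddCommGroup A] [Module R A]
    [AddCommGroup F] [Module R F] [Module.Flat R F] (f : F →ₗ[R] A) (hf : Function.Surjective f)
    (n : ℕ) : ∀ (B : Type u) [AddCommGroup B] [Module R B], TorIndepUpTo (R := R) A (n + 1) B →
      TorIndepUpTo (R := R) (LinearMap.ker f) n B := by
  induction n with
  | zero => intros; trivial
  | succ n ih =>
    rintro B _ _ ⟨G, _, _, g, hG, hg, hinj, G', _, _, g', hG', hg', hinj', hind⟩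
    refine ⟨G, _, _, g, hG, hg, ?_, ih _ ⟨G', _, _, g', hG', hg', hinj', hind⟩⟩
    have h1 := injective_rTensor_of_injective_lTensor f hf g' hg' hinj'
    have h2 := Module.Flat.lTensor_preserves_injective_linearMap (M := F)
      (LinearMap.ker g).subtype (LinearMap.ker g).subtype_injective
    have h3 := h2.comp h1
    rw [← LinearMap.coe_comp, LinearMap.lTensor_comp_rTensor,
      ← LinearMap.rTensor_comp_lTensor, LinearMap.coe_comp] at h3
    exact h3.of_comp

theorem TorIndep.ker {A B F : Type u} [AddCommGroup A] [Module R A] [AddCommGroup B] [Module R B]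
    [AddCommGroup F] [Module R F] [Module.Flat R F] (f : F →ₗ[R] A) (hf : Function.Surjective f)
    (h : TorIndep R A B) : TorIndep R (LinearMap.ker f) B :=
  fun n => TorIndepUpTo.ker f hf n B (h (n + 1))

theorem TorIndep.injective_rTensor {A B F : Type u} [AddCommGroup A] [Module R A]
    [AddCommGroup B] [Module R B] [AddCommGroup F] [Module R F]
    (f : F →ₗ[R] A) (hf : Function.Surjective f)
    (h : TorIndep R A B) : Function.Injective ((LinearMap.ker f).subtype.rTensor B) := by
  obtain ⟨G, _, _, g, hG, hg, hinj, -⟩ := h 1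
  exact injective_rTensor_of_injective_lTensor f hf g hg hinj

/-- Balance of Tor: a free resolution of `A` is built one syzygy at a time, each of them still
Tor-independent of `B`. -/
theorem TorIndep.symm {A B : Type u} [AddCommGroup A] [Module R A] [AddCommGroup B] [Module R B]
    (h : TorIndep R A B) : TorIndep R B A := by
  intro n
  induction n generalizing A with
  | zero => trivial
  | succ n ih =>
    have hf : Function.Surjective (Finsupp.linearCombination R (id : A → A)) :=
      Finsupp.linearCombination_id_surjective R A
    refine ⟨A →₀ R, _, _, _, inferInstance, hf, ?_, ih (h.ker _ hf)⟩
    have := h.injective_rTensor _ hf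
    rwa [LinearMap.lTensor_inj_iff_rTensor_inj]

open MonoidalCategory in
theorem torIndep_of_isZero_tor (A B : Type u) [AddCommGroup A] [Module R A] [AddCommGroup B]
    [Module R B] (h : ∀ i : ℕ, 0 < i →
      Limits.IsZero (((Tor (ModuleCat.{u} R) i).obj (ModuleCat.of R A)).obj (ModuleCat.of R B))) :
    TorIndep R A B := by
  let P := projectiveResolution (ModuleCat.of R B)
  have : ∀ n, Module.Projective R (P.complex.X n) := fun n =>
    (IsProjective.iff_projective (P.complex.X n)).2 (P.projective n)
  have hexact : ∀ n, Function.Exact (P.complex.d (n + 2) (n + 1)).hom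
      (P.complex.d (n + 1) n).hom := fun n =>
    (ShortComplex.ShortExact.moduleCat_exact_iff_function_exact _).1 (P.exact_succ n)
  have hA : ∀ n, Function.Exact ((P.complex.d (n + 2) (n + 1)).hom.lTensor A)
      ((P.complex.d (n + 1) n).hom.lTensor A) := by
    intro n
    have hz := (h (n + 1) n.succ_pos).of_iso
      (P.isoLeftDerivedObj ((tensoringLeft (ModuleCat.{u} R)).obj (ModuleCat.of R A)) (n + 1)).symm
    have hex := (HomologicalComplex.exactAt_iff_isZero_homology _ (n + 1)).2 hz
    rw [HomologicalComplex.exactAt_iff' _ (n + 2) (n + 1) n (by simp) (by simp),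
      ShortComplex.ShortExact.moduleCat_exact_iff_function_exact] at hex
    exact hex
  have h0 : Function.Exact (P.complex.d 1 0).hom (P.π.f 0).hom :=
    (ShortComplex.ShortExact.moduleCat_exact_iff_function_exact _).1 P.exact₀
  have hs : Function.Surjective (P.π.f 0).hom :=
    (ModuleCat.epi_iff_surjective _).1 inferInstance
  intro n
  exact torIndepUpTo_of_resolution A (fun n => P.complex.X n) (fun n => (P.complex.d (n + 1) n).hom)
    hexact hA n 0 B (P.π.f 0).hom hs h0

end TorIndependence

/-! ### Rank-nullity on subspaces -/

section Dimension

variable {k V W : Type*} [Field k] [AddCommGroup V] [Module k V] [AddCommGroup W] [Module k W]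

theorem finrank_map_add_finrank_inf_ker (f : V →ₗ[k] W) (A : Submodule k V)
    [FiniteDimensional k A] :
    Module.finrank k (A.map f) + Module.finrank k (A ⊓ LinearMap.ker f : Submodule k V) =
      Module.finrank k A := by
  have h := LinearMap.finrank_range_add_finrank_ker (f.domRestrict A)
  rw [LinearMap.range_domRestrict, LinearMap.ker_domRestrict] at h
  rw [← h, ← Submodule.map_comap_subtype]
  congr 1
  exact (Submodule.equivSubtypeMap A _).symm.finrank_eq

theorem finrank_map_of_injOn (f : V →ₗ[k] W) (A : Submodule k V) (h : ∀ v ∈ A, f v = 0 → v = 0) :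
    Module.finrank k (A.map f) = Module.finrank k A := by
  have : Function.Injective (f.domRestrict A) := by
    rw [injective_iff_map_eq_zero]
    exact fun v hv => Subtype.ext (h v v.2 hv)
  rw [← LinearMap.range_domRestrict]
  exact LinearMap.finrank_range_of_inj this

theorem finrank_submodulePi {ι : Type*} [Fintype ι] (p : ι → Submodule k V)
    [∀ j, FiniteDimensional k (p j)] :
    Module.finrank k (Submodule.pi Set.univ p) = ∑ j, Module.finrank k (p j) := by
  have h : Submodule.pi Set.univ p = LinearMap.range
      (LinearMap.pi fun j => (p j).subtype ∘ₗ LinearMap.proj j : (∀ j, p j) →ₗ[k] ι → V) := by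
    ext v
    simp only [Submodule.mem_pi, Set.mem_univ, true_implies, LinearMap.mem_range]
    exact ⟨fun hv => ⟨fun j => ⟨v j, hv j⟩, rfl⟩, by rintro ⟨w, rfl⟩ j; exact (w j).2⟩
  rw [h, LinearMap.finrank_range_of_inj, Module.finrank_pi_fintype]
  intro v w hvw
  funext j
  exact Subtype.ext (congr_fun hvw j)

instance finiteDimensional_submodulePi {ι : Type*} [Fintype ι] (p : ι → Submodule k V)
    [∀ j, FiniteDimensional k (p j)] : FiniteDimensional k (Submodule.pi Set.univ p) := by
  let f : Submodule.pi Set.univ p →ₗ[k] ∀ j, p j :=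
    LinearMap.pi fun j => (LinearMap.proj j ∘ₗ (Submodule.pi Set.univ p).subtype).codRestrict (p j)
      fun v => (Submodule.mem_pi.1 v.2) j trivial
  refine FiniteDimensional.of_injective f fun v w h => ?_
  apply Subtype.ext
  funext j
  exact congr_arg Subtype.val (congr_fun h j)

end Dimension

/-! ### Homogeneous generators, finiteness and free covers -/

section Generators

variable {k : Type*} {R M : Type u} [Field k] [CommRing R] [Algebra k R]
  [AddCommGroup M] [Module R M] [Module k M] [IsScalarTower k R M]

theorem finiteDimensional_freeGrading {ι : Type*} [Fintype ι] (𝒜 : ℤ → Submodule k R) (d : ι → ℤ)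
    (n : ℤ) (h : ∀ j, FiniteDimensional k (𝒜 (n - d j))) :
    FiniteDimensional k (freeGrading 𝒜 d n) :=
  finiteDimensional_submodulePi _

theorem le_map_linearCombination {ι : Type*} [Fintype ι] (𝒜 : ℤ → Submodule k R) [GradedAlgebra 𝒜]
    (ℳ : ℤ → Submodule k M) [DirectSum.Decomposition ℳ] [SetLike.GradedSMul 𝒜 ℳ]
    {d : ι → ℤ} {y : ι → M} (hy : ∀ j, y j ∈ ℳ (d j)) {n : ℤ}
    (h : ∀ x ∈ ℳ n, x ∈ Submodule.span R (Set.range y)) :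
    ℳ n ≤ (freeGrading 𝒜 d n).map ((Fintype.linearCombination R y).restrictScalars k) := by
  let := (freeGrading_isInternal 𝒜 d).chooseDecomposition
  intro x hx
  have hx' := h x hx
  rw [← Fintype.range_linearCombination] at hx'
  exact exists_mem_of_mem_range (Fintype.linearCombination R y)
    (fun n v hv => linearCombination_mem hy n v hv) hx hx'

variable (𝒜 : ℤ → Submodule k R) [GradedAlgebra 𝒜]

/-- The ideal generated by all homogeneous elements of degree at least `n` has finitely many
generators of that kind. In degree `n` their coefficients have degree at most 0, hence lie in `k` or
vanish. -/
theorem IsPositivelyGraded.finiteDimensional [IsNoetherianRing R] (h𝒜 : IsPositivelyGraded 𝒜)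
    (n : ℤ) : FiniteDimensional k (𝒜 n) := by
  obtain ⟨S, hS, hspan⟩ := (Submodule.fg_span_iff_fg_span_finset_subset
    {x : R | ∃ i, n ≤ i ∧ x ∈ 𝒜 i}).1 (IsNoetherian.noetherian (Submodule.span R _))
  choose d hd hS using fun s : S => hS s.2
  have hle := le_map_linearCombination 𝒜 𝒜 (y := ((↑) : S → R)) hS (n := n) (fun x hx => by
    have : x ∈ Submodule.span R {x : R | ∃ i, n ≤ i ∧ x ∈ 𝒜 i} :=
      Submodule.subset_span ⟨n, le_rfl, hx⟩
    rw [hspan] at this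
    simpa using this)
  have h0 : FiniteDimensional k (𝒜 0) := by
    have : 𝒜 0 = LinearMap.range (Algebra.linearMap k R) :=
      SetLike.coe_injective h𝒜.range_algebraMap.symm
    rw [this]
    infer_instance
  have := finiteDimensional_freeGrading 𝒜 d n fun j => by
    rcases (hd j).lt_or_eq with h | h
    · rw [h𝒜.eq_bot_of_neg _ (by omega)]
      infer_instance
    · rw [← h, sub_self]
      exact h0
  exact Submodule.finiteDimensional_of_le hle

theorem IsPositivelyGraded.hasHilbertSeries [IsNoetherianRing R] (h𝒜 : IsPositivelyGraded 𝒜) :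
    HasHilbertSeries 𝒜 :=
  ⟨h𝒜.finiteDimensional, 0, fun i hi => not_lt.1 fun h => hi (h𝒜.eq_bot_of_neg i h)⟩

theorem freeGrading_eq_bot {ι : Type*} {𝒜 : ℤ → Submodule k R} (h𝒜 : IsPositivelyGraded 𝒜)
    {d : ι → ℤ} {n : ℤ} (h : ∀ j, n < d j) : freeGrading 𝒜 d n = ⊥ := by
  rw [eq_bot_iff]
  intro v hv
  refine funext fun j => ?_
  have := mem_freeGrading.1 hv j
  rw [h𝒜.eq_bot_of_neg _ (by linarith [h j])] at this
  exact this

variable (ℳ : ℤ → Submodule k M) [DirectSum.Decomposition ℳ]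

theorem exists_homogeneous_generators [Module.Finite R M] :
    ∃ S : Finset M, (∀ s ∈ S, ∃ i, s ∈ ℳ i) ∧ Submodule.span R (S : Set M) = ⊤ := by
  have htop : Submodule.span R {x : M | ∃ i, x ∈ ℳ i} = ⊤ := by
    rw [eq_top_iff]
    intro x _
    induction x using DirectSum.Decomposition.inductionOn ℳ with
    | zero => exact zero_mem _
    | add x y hx hy => exact add_mem (hx trivial) (hy trivial)
    | @homogeneous i x => exact Submodule.subset_span ⟨i, x.2⟩
  obtain ⟨S, hS, hspan⟩ := (Submodule.fg_span_iff_fg_span_finset_subset _).1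
    (htop ▸ Module.Finite.fg_top : (Submodule.span R {x : M | ∃ i, x ∈ ℳ i}).FG)
  exact ⟨S, hS, hspan ▸ htop⟩

/-- The components of a finitely generated graded module over a positively graded Noetherian
algebra are finite-dimensional and vanish in sufficiently negative degrees. -/
theorem IsPositivelyGraded.hasHilbertSeries_module {𝒜 : ℤ → Submodule k R} [GradedAlgebra 𝒜]
    [SetLike.GradedSMul 𝒜 ℳ] [IsNoetherianRing R] [Module.Finite R M]
    (h𝒜 : IsPositivelyGraded 𝒜) : HasHilbertSeries ℳ := by
  obtain ⟨S, hS, hspan⟩ := exists_homogeneous_generators (R := R) ℳ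
  choose d hS using fun s : S => hS s s.2
  have hle := fun n => le_map_linearCombination 𝒜 ℳ (y := ((↑) : S → M)) hS (n := n)
    (fun x hx => by simp [hspan])
  have : ∀ n, FiniteDimensional k (freeGrading 𝒜 d n) := fun n =>
    finiteDimensional_freeGrading 𝒜 d n fun j => h𝒜.finiteDimensional 𝒜 _
  obtain ⟨m, hm⟩ := (Set.finite_range d).bddBelow
  refine ⟨fun n => Submodule.finiteDimensional_of_le (hle n), m, fun n hn => ?_⟩
  by_contra! hlt
  refine hn (eq_bot_iff.2 ((hle n).trans ?_))
  rw [freeGrading_eq_bot h𝒜 fun j => hlt.trans_le (hm ⟨j, rfl⟩), Submodule.map_bot]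

/-- A graded free cover which is minimal in the lowest degree `m`. -/
theorem exists_free_cover {𝒜 : ℤ → Submodule k R} [GradedAlgebra 𝒜]
    [SetLike.GradedSMul 𝒜 ℳ] [IsNoetherianRing R] [Module.Finite R M]
    (h𝒜 : IsPositivelyGraded 𝒜) (m : ℤ) (hm : ∀ i < m, ℳ i = ⊥) :
    ∃ (ι : Type u) (_ : Fintype ι) (d : ι → ℤ) (y : ι → M), (∀ j, y j ∈ ℳ (d j)) ∧
      (∀ j, m ≤ d j) ∧ Function.Surjective (Fintype.linearCombination R y) ∧
      ∀ v ∈ freeGrading 𝒜 d m, Fintype.linearCombination R y v = 0 → v = 0 := by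
  classical
  obtain ⟨S, hS, hspan⟩ := exists_homogeneous_generators (R := R) ℳ
  have := (h𝒜.hasHilbertSeries_module ℳ).finite m
  let b := Module.finBasis k (ℳ m)
  -- The generators of degree `m` are replaced by a `k`-basis of `ℳ m`, which makes the cover
  -- injective in degree `m`.
  let S' := S.filter fun s => ∃ i, m < i ∧ s ∈ ℳ i
  choose d hd hdS using fun s : S' => (Finset.mem_filter.1 s.2).2
  let e : Fin (Module.finrank k (ℳ m)) ⊕ S' → ℤ := Sum.elim (fun _ => m) d
  let y : Fin (Module.finrank k (ℳ m)) ⊕ S' → M := Sum.elim (fun j => (b j : M)) (fun s => s)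
  refine ⟨Fin (Module.finrank k (ℳ m)) ⊕ S', inferInstance, e, y, ?_, ?_, ?_, ?_⟩
  · rintro (j | s)
    · exact (b j).2
    · exact hdS s
  · rintro (j | s)
    · exact le_rfl
    · exact (hd s).le
  · rw [← LinearMap.range_eq_top, Fintype.range_linearCombination, eq_top_iff, ← hspan,
      Submodule.span_le]
    intro s hs
    obtain ⟨i, hi⟩ := hS s hs
    rcases lt_trichotomy i m with h | h | h
    · rw [hm i h] at hi
      rw [(Submodule.mem_bot k).1 hi]
      exact zero_mem _
    · subst h
      have h := congr_arg Subtype.val (b.sum_repr ⟨s, hi⟩)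
      rw [← show _ = s from h, AddSubmonoidClass.coe_finsetSum]
      refine sum_mem fun j _ => ?_
      rw [Submodule.coe_smul, ← algebraMap_smul R]
      exact Submodule.smul_mem _ _ (Submodule.subset_span ⟨Sum.inl j, rfl⟩)
    · exact Submodule.subset_span ⟨Sum.inr ⟨s, Finset.mem_filter.2 ⟨hs, i, h, hi⟩⟩, rfl⟩
  · intro v hv hv0
    rw [mem_freeGrading] at hv
    -- In degree `m`, coefficients of higher generators have negative degree and vanish; those of
    -- the basis have degree 0, so they are scalars.
    have hr : ∀ s, v (Sum.inr s) = 0 := fun s => by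
      have : v (Sum.inr s) ∈ 𝒜 (m - d s) := hv (Sum.inr s)
      rwa [h𝒜.eq_bot_of_neg _ (sub_neg.2 (hd s))] at this
    have hl : ∀ j, ∃ c : k, algebraMap k R c = v (Sum.inl j) := fun j => by
      have : v (Sum.inl j) ∈ (𝒜 0 : Set R) := by simpa [e] using hv (Sum.inl j)
      rwa [← h𝒜.range_algebraMap] at this
    choose c hc using hl
    have hc0 : ∑ j, c j • b j = 0 := by
      apply Subtype.ext
      rw [AddSubmonoidClass.coe_finsetSum]
      rw [Fintype.linearCombination_apply, Fintype.sum_sum_type] at hv0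
      simpa [hr, y, ← hc] using hv0
    have := Fintype.linearIndependent_iff.1 b.linearIndependent c hc0
    funext j
    rcases j with j | s
    · simp [← hc, this]
    · exact hr s

end Generators

/-! ### Functoriality and finiteness of the tensor grading -/

section TensorGradingProperties

variable {k : Type*} {R M N : Type u} [Field k] [CommRing R] [Algebra k R]
  [AddCommGroup M] [Module R M] [Module k M] [IsScalarTower k R M]
  [AddCommGroup N] [Module R N] [Module k N] [IsScalarTower k R N]
  {ℳ : ℤ → Submodule k M} {𝒩 : ℤ → Submodule k N}

theorem tensorGrading_gradedSMul (𝒜 : ℤ → Submodule k R) [SetLike.GradedSMul 𝒜 ℳ] :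
    SetLike.GradedSMul 𝒜 (tensorGrading R ℳ 𝒩) where
  smul_mem := fun {i j a z} ha hz => by
    let f : M ⊗[R] N →ₗ[k] M ⊗[R] N := (LinearMap.lsmul R (M ⊗[R] N) a).restrictScalars k
    have : tensorGrading R ℳ 𝒩 j ≤ (tensorGrading R ℳ 𝒩 (i + j)).comap f := by
      refine tensorGrading_le fun p q hpq x hx y hy => ?_
      change a • (x ⊗ₜ[R] y) ∈ tensorGrading R ℳ 𝒩 (i + j)
      rw [TensorProduct.smul_tmul', ← hpq, ← add_assoc]
      exact tmul_mem_tensorGrading (SetLike.GradedSMul.smul_mem (A := 𝒜) (B := ℳ) ha hx) hy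
    exact this hz

theorem tensorGrading_eq_bot {m m' n : ℤ} (hm : ∀ i < m, ℳ i = ⊥) (hm' : ∀ i < m', 𝒩 i = ⊥)
    (hn : n < m + m') : tensorGrading R ℳ 𝒩 n = ⊥ := by
  rw [eq_bot_iff]
  refine tensorGrading_le fun i j hij x hx y hy => ?_
  rcases lt_or_ge i m with h | h
  · rw [hm i h] at hx
    simp [(Submodule.mem_bot k).1 hx]
  · rw [hm' j (by omega)] at hy
    simp [(Submodule.mem_bot k).1 hy]

theorem tensorGrading_map_mem {M' N' : Type u} [AddCommGroup M'] [Module R M'] [Module k M']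
    [IsScalarTower k R M'] [AddCommGroup N'] [Module R N'] [Module k N'] [IsScalarTower k R N']
    {ℳ' : ℤ → Submodule k M'} {𝒩' : ℤ → Submodule k N'}
    (f : M →ₗ[R] M') (g : N →ₗ[R] N') (hf : ∀ n, ∀ x ∈ ℳ n, f x ∈ ℳ' n)
    (hg : ∀ n, ∀ x ∈ 𝒩 n, g x ∈ 𝒩' n) (n : ℤ) (z : M ⊗[R] N)
    (hz : z ∈ tensorGrading R ℳ 𝒩 n) : TensorProduct.map f g z ∈ tensorGrading R ℳ' 𝒩' n := by
  have : tensorGrading R ℳ 𝒩 n ≤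
      (tensorGrading R ℳ' 𝒩' n).comap ((TensorProduct.map f g).restrictScalars k) := by
    refine tensorGrading_le fun p q hpq x hx y hy => ?_
    subst hpq
    exact tmul_mem_tensorGrading (hf p x hx) (hg q y hy)
  exact this hz

theorem tensorGrading_comm_mem (n : ℤ) (z : M ⊗[R] N) (hz : z ∈ tensorGrading R ℳ 𝒩 n) :
    TensorProduct.comm R M N z ∈ tensorGrading R 𝒩 ℳ n := by
  have : tensorGrading R ℳ 𝒩 n ≤ (tensorGrading R 𝒩 ℳ n).comap
      ((TensorProduct.comm R M N).toLinearMap.restrictScalars k) := by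
    refine tensorGrading_le fun p q hpq x hx y hy => ?_
    subst hpq
    rw [add_comm]
    exact tmul_mem_tensorGrading hy hx
  exact this hz

theorem IsPositivelyGraded.hasHilbertSeries_tensor {𝒜 : ℤ → Submodule k R} [GradedAlgebra 𝒜]
    [DirectSum.Decomposition ℳ] [DirectSum.Decomposition 𝒩]
    [SetLike.GradedSMul 𝒜 ℳ] [SetLike.GradedSMul 𝒜 𝒩] [IsNoetherianRing R] [Module.Finite R M]
    [Module.Finite R N] (h𝒜 : IsPositivelyGraded 𝒜) :
    HasHilbertSeries (tensorGrading R ℳ 𝒩) := by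
  let := (tensorGrading_isInternal ℳ 𝒩 𝒜).chooseDecomposition
  have := tensorGrading_gradedSMul (ℳ := ℳ) (𝒩 := 𝒩) 𝒜
  exact h𝒜.hasHilbertSeries_module _

end TensorGradingProperties

/-! ### Eigenspaces of the exchange of factors -/

section SwapGrading

variable {k : Type*} {R M : Type u} [Field k] [CommRing R] [Algebra k R]
  [AddCommGroup M] [Module R M] [Module k M] [IsScalarTower k R M]

variable (k R M) in
/-- The exchange of factors on `M ⊗ M`, as a `k`-linear map. -/
def tensorSwap : M ⊗[R] M →ₗ[k] M ⊗[R] M :=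
  (TensorProduct.comm R M M).toLinearMap.restrictScalars k

theorem tensorSwap_apply (z : M ⊗[R] M) : tensorSwap k R M z = TensorProduct.comm R M M z := rfl

theorem tensorSwap_tensorSwap (z : M ⊗[R] M) : tensorSwap k R M (tensorSwap k R M z) = z :=
  TensorProduct.comm_comm R M M z

variable (R) in
/-- The elements of degree `n` of `M ⊗ M` on which the exchange of factors acts by `ε`. -/
def swapGrading (ε : k) (ℳ : ℤ → Submodule k M) (n : ℤ) : Submodule k (M ⊗[R] M) :=
  tensorGrading R ℳ ℳ n ⊓ LinearMap.ker (tensorSwap k R M - ε • LinearMap.id)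

theorem mem_swapGrading {ε : k} {ℳ : ℤ → Submodule k M} {n : ℤ} {z : M ⊗[R] M} :
    z ∈ swapGrading R ε ℳ n ↔ z ∈ tensorGrading R ℳ ℳ n ∧ tensorSwap k R M z = ε • z := by
  simp [swapGrading, sub_eq_zero]

variable (ℳ : ℤ → Submodule k M)

theorem swapGrading_le (ε : k) (n : ℤ) : swapGrading R ε ℳ n ≤ tensorGrading R ℳ ℳ n :=
  inf_le_left

theorem symmetrize_mem_swapGrading {ε : k} (hε : ε * ε = 1) (c : k) {n : ℤ} {z : M ⊗[R] M}
    (hz : z ∈ tensorGrading R ℳ ℳ n) :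
    c • (z + ε • tensorSwap k R M z) ∈ swapGrading R ε ℳ n := by
  refine mem_swapGrading.2 ⟨Submodule.smul_mem _ _ (add_mem hz (Submodule.smul_mem _ _
    (tensorGrading_comm_mem n z hz))), ?_⟩
  rw [map_smul, map_add, map_smul, tensorSwap_tensorSwap, smul_comm ε c, smul_add ε, smul_smul ε ε,
    hε, one_smul, add_comm]

theorem symmetrize_eq_self {ε : k} (hε : ε * ε = 1) (h2 : (2 : k) ≠ 0) {z : M ⊗[R] M}
    (hz : tensorSwap k R M z = ε • z) : (2⁻¹ : k) • (z + ε • tensorSwap k R M z) = z := by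
  rw [hz, smul_smul, hε, one_smul, ← two_smul k z, smul_smul, inv_mul_cancel₀ h2, one_smul]

theorem finrank_tensorGrading_eq (h2 : (2 : k) ≠ 0) (n : ℤ)
    [FiniteDimensional k (tensorGrading R ℳ ℳ n)] :
    Module.finrank k (tensorGrading R ℳ ℳ n) =
      Module.finrank k (swapGrading R (1 : k) ℳ n) +
        Module.finrank k (swapGrading R (-1 : k) ℳ n) := by
  suffices h : (tensorGrading R ℳ ℳ n).map (tensorSwap k R M - (1 : k) • LinearMap.id) =
      swapGrading R (-1 : k) ℳ n by
    rw [← finrank_map_add_finrank_inf_ker (tensorSwap k R M - (1 : k) • LinearMap.id)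
      (tensorGrading R ℳ ℳ n), add_comm, h]
    rfl
  ext w
  simp only [Submodule.mem_map, mem_swapGrading]
  constructor
  · rintro ⟨z, hz, rfl⟩
    have := mem_swapGrading.1 (symmetrize_mem_swapGrading ℳ (ε := (-1 : k)) (by simp) (-1) hz)
    convert this using 2 <;> simp <;> abel
  · rintro ⟨hw, hw'⟩
    -- On the `-1`-eigenspace, the exchange minus the identity is multiplication by `-2`.
    refine ⟨(-2⁻¹ : k) • w, Submodule.smul_mem _ _ hw, ?_⟩
    have := symmetrize_eq_self (by simp) h2 hw'
    rw [LinearMap.sub_apply, map_smul, hw', LinearMap.smul_apply, LinearMap.id_apply, one_smul,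
      smul_smul, ← sub_smul]
    have h : (-2⁻¹ * -1 - -2⁻¹ : k) = 1 := by field_simp; norm_num
    rw [h, one_smul]

/-- A quotient of `M ⊗ M` that identifies `y ⊗ x` with `ε • x ⊗ y`, and no more than that, has the
dimensions of the `ε`-eigenspace of the exchange of factors. -/
theorem finrank_map_eq_finrank_swapGrading {S : Type*} [AddCommGroup S] [Module k S]
    {ε : k} (hε : ε * ε = 1) (h2 : (2 : k) ≠ 0) (p : M ⊗[R] M →ₗ[k] S) (s : S → M ⊗[R] M)
    (hs0 : s 0 = 0)
    (hp : ∀ z, p (tensorSwap k R M z) = ε • p z) (hs : ∀ z, s (p z) = z + ε • tensorSwap k R M z)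
    (n : ℤ) : Module.finrank k ((tensorGrading R ℳ ℳ n).map p) =
      Module.finrank k (swapGrading R ε ℳ n) := by
  have : (tensorGrading R ℳ ℳ n).map p = (swapGrading R ε ℳ n).map p := by
    refine le_antisymm ?_ (Submodule.map_mono (swapGrading_le ℳ ε n))
    rintro _ ⟨z, hz, rfl⟩
    refine ⟨_, symmetrize_mem_swapGrading ℳ hε 2⁻¹ hz, ?_⟩
    rw [map_smul, map_add, map_smul, hp, smul_smul, hε, one_smul, ← two_smul k (p z), smul_smul,
      inv_mul_cancel₀ h2, one_smul]
  rw [this]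
  -- On the `ε`-eigenspace `s ∘ p` is multiplication by 2, so `p` is injective there.
  refine finrank_map_of_injOn p _ fun z hz hz0 => ?_
  rw [← symmetrize_eq_self hε h2 (mem_swapGrading.1 hz).2, ← hs, hz0, hs0, smul_zero]

end SwapGrading

/-! ### Symmetric and exterior squares as eigenspaces -/

section Squares

variable {k : Type*} {R M : Type u} [Field k] [CommRing R] [Algebra k R]
  [AddCommGroup M] [Module R M] [Module k M] [IsScalarTower k R M] (ℳ : ℤ → Submodule k M)

theorem symSqGrading_eq_map (n : ℤ) : symSqGrading R ℳ n =
    (tensorGrading R ℳ ℳ n).map ((symSqRel R M).mkQ.restrictScalars k) := by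
  rw [symSqGrading, tensorGrading, Submodule.map_span]
  congr 1
  ext z
  constructor
  · rintro ⟨i, j, hij, x, hx, y, hy, rfl⟩
    exact ⟨_, ⟨i, j, hij, x, hx, y, hy, rfl⟩, rfl⟩
  · rintro ⟨_, ⟨i, j, hij, x, hx, y, hy, rfl⟩, rfl⟩
    exact ⟨i, j, hij, x, hx, y, hy, rfl⟩

variable (R M) in
/-- The map `M ⊗ M → ⋀² M`, `x ⊗ y ↦ x ∧ y`. -/
noncomputable def tensorToExtSq : M ⊗[R] M →ₗ[R] ⋀[R]^2 M :=
  TensorProduct.lift (LinearMap.mk₂ R (fun x y => exteriorPower.ιMulti R 2 ![x, y])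
    (fun x x' y => (exteriorPower.ιMulti R 2).map_vecCons_add ![y] x x')
    (fun c x y => (exteriorPower.ιMulti R 2).map_vecCons_smul ![y] c x)
    (fun x y y' => ((exteriorPower.ιMulti R 2).curryLeft x).map_vecCons_add ![] y y')
    (fun c x y => ((exteriorPower.ιMulti R 2).curryLeft x).map_vecCons_smul ![] c y))

theorem extSqGrading_eq_map (n : ℤ) : extSqGrading R ℳ n =
    (tensorGrading R ℳ ℳ n).map ((tensorToExtSq R M).restrictScalars k) := by
  rw [extSqGrading, tensorGrading, Submodule.map_span]
  congr 1
  ext z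
  constructor
  · rintro ⟨i, j, hij, x, hx, y, hy, rfl⟩
    exact ⟨_, ⟨i, j, hij, x, hx, y, hy, rfl⟩, rfl⟩
  · rintro ⟨_, ⟨i, j, hij, x, hx, y, hy, rfl⟩, rfl⟩
    exact ⟨i, j, hij, x, hx, y, hy, rfl⟩

variable (R M) in
/-- The antisymmetrization `x ∧ y ↦ x ⊗ y - y ⊗ x`. -/
noncomputable def extSqToTensor : ⋀[R]^2 M →ₗ[R] M ⊗[R] M :=
  exteriorPower.alternatingMapLinearEquiv
    { toFun := fun v => v 0 ⊗ₜ[R] v 1 - v 1 ⊗ₜ[R] v 0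
      map_update_add' := fun v i x y => by
        fin_cases i <;> simp [TensorProduct.add_tmul, TensorProduct.tmul_add] <;> abel
      map_update_smul' := fun v i c x => by
        fin_cases i <;> simp [TensorProduct.smul_tmul', smul_sub]
      map_eq_zero_of_eq' := fun v i j h hij => by
        fin_cases i <;> fin_cases j <;> simp_all }

theorem extSqToTensor_ιMulti (x y : M) :
    extSqToTensor R M (exteriorPower.ιMulti R 2 ![x, y]) = x ⊗ₜ[R] y - y ⊗ₜ[R] x := by
  rw [extSqToTensor, exteriorPower.alternatingMapLinearEquiv_apply_ιMulti]
  rfl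

/-- The return map is `x y ↦ x ⊗ y + y ⊗ x`, well defined because it kills the relations `x ⊗ y - y
⊗ x`. -/
theorem finrank_symSqGrading (h2 : (2 : k) ≠ 0) (n : ℤ) :
    Module.finrank k (symSqGrading R ℳ n) = Module.finrank k (swapGrading R (1 : k) ℳ n) := by
  rw [symSqGrading_eq_map]
  have hle : symSqRel R M ≤
      LinearMap.ker (LinearMap.id + (TensorProduct.comm R M M).toLinearMap) := by
    refine Submodule.span_le.2 ?_
    rintro _ ⟨x, y, rfl⟩
    simp
  refine finrank_map_eq_finrank_swapGrading ℳ (by simp) h2 _ ((symSqRel R M).liftQ _ hle)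
    (map_zero _) (fun z => ?_) (fun z => ?_) n
  · induction z using TensorProduct.induction_on with
    | zero => simp
    | add x y hx hy => simp only [map_add, smul_add, hx, hy]
    | tmul x y =>
      rw [one_smul]
      exact (Submodule.Quotient.eq _).2 (Submodule.subset_span ⟨y, x, rfl⟩)
  · rw [one_smul]
    exact Submodule.liftQ_apply _ _ _

theorem finrank_extSqGrading (h2 : (2 : k) ≠ 0) (n : ℤ) :
    Module.finrank k (extSqGrading R ℳ n) = Module.finrank k (swapGrading R (-1 : k) ℳ n) := by
  rw [extSqGrading_eq_map]
  refine finrank_map_eq_finrank_swapGrading ℳ (by simp) h2 _ (extSqToTensor R M)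
    (map_zero _) (fun z => ?_) (fun z => ?_) n
  · induction z using TensorProduct.induction_on with
    | zero => simp
    | add x y hx hy => simp only [map_add, smul_add, hx, hy]
    | tmul x y =>
      rw [neg_one_smul]
      change exteriorPower.ιMulti R 2 ![y, x] = -exteriorPower.ιMulti R 2 ![x, y]
      have := (exteriorPower.ιMulti R 2 (M := M)).map_swap ![x, y] (i := 0) (j := 1) (by simp)
      rw [← this]
      congr 1
      funext i
      fin_cases i <;> rfl
  · induction z using TensorProduct.induction_on with
    | zero => simp
    | add x y hx hy =>
      simp only [map_add, smul_add, hx, hy]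
      abel
    | tmul x y =>
      rw [neg_one_smul, ← sub_eq_add_neg]
      exact extSqToTensor_ιMulti x y

end Squares

/-! ### The four-term exact sequence of eigenspaces -/

section SwapSequence

variable {k : Type*} {R F M : Type u} [Field k] [CommRing R] [Algebra k R]
  [AddCommGroup F] [Module R F] [Module k F] [IsScalarTower k R F]
  [AddCommGroup M] [Module R M] [Module k M] [IsScalarTower k R M]

theorem tensorSwap_map (f : F →ₗ[R] M) (z : F ⊗[R] F) :
    tensorSwap k R M (TensorProduct.map f f z) = TensorProduct.map f f (tensorSwap k R F z) := by
  induction z using TensorProduct.induction_on with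
  | zero => simp
  | add x y hx hy => simp only [map_add, hx, hy]
  | tmul x y => rfl

theorem map_restrictScalars_smul (f : F →ₗ[R] M) (c : k) (x : F) : f (c • x) = c • f x :=
  map_smul (f.restrictScalars k) c x

variable {ℱ : ℤ → Submodule k F} [DirectSum.Decomposition ℱ]
  {ℳ : ℤ → Submodule k M} [DirectSum.Decomposition ℳ]

/-- Exactness at `(M ⊗ M)^ε`: a homogeneous preimage of an eigenvector becomes an eigenvector when
averaged under the exchange. -/
theorem swapGrading_map_eq
    (𝒜 : ℤ → Submodule k R) [GradedAlgebra 𝒜] [SetLike.GradedSMul 𝒜 ℱ] [SetLike.GradedSMul 𝒜 ℳ]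
    (f : F →ₗ[R] M) (hf : ∀ n, ∀ x ∈ ℱ n, f x ∈ ℳ n)
    (hs : Function.Surjective f) {ε : k} (hε : ε * ε = 1) (h2 : (2 : k) ≠ 0) (n : ℤ) :
    (swapGrading R ε ℱ n).map ((TensorProduct.map f f).restrictScalars k) =
      swapGrading R ε ℳ n := by
  let := (tensorGrading_isInternal ℱ ℱ 𝒜).chooseDecomposition
  let := (tensorGrading_isInternal ℳ ℳ 𝒜).chooseDecomposition
  refine le_antisymm ?_ fun w hw => ?_
  · rintro _ ⟨z, hz, rfl⟩
    have hz' := mem_swapGrading.1 hz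
    refine mem_swapGrading.2 ⟨tensorGrading_map_mem f f hf hf n z hz'.1, ?_⟩
    rw [LinearMap.restrictScalars_apply, tensorSwap_map, hz'.2, map_restrictScalars_smul]
  · have hw' := mem_swapGrading.1 hw
    obtain ⟨z, hz, rfl⟩ := exists_mem_of_mem_range (TensorProduct.map f f)
      (tensorGrading_map_mem f f hf hf) hw'.1 (TensorProduct.map_surjective hs hs w)
    refine ⟨_, symmetrize_mem_swapGrading ℱ hε 2⁻¹ hz, ?_⟩
    rw [map_smul, map_add, map_smul, LinearMap.restrictScalars_apply,
      LinearMap.restrictScalars_apply, ← tensorSwap_map, symmetrize_eq_self hε h2 hw'.2]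

variable (k) in
/-- The map `K ⊗ F → F ⊗ F`, `x ⊗ y ↦ x ⊗ y + ε • y ⊗ x`. -/
def symmetrizeIncl (K : Submodule R F) (ε : k) : K ⊗[R] F →ₗ[k] F ⊗[R] F :=
  (LinearMap.id + ε • tensorSwap k R F) ∘ₗ (K.subtype.rTensor F).restrictScalars k

theorem symmetrizeIncl_apply (K : Submodule R F) (ε : k) (w : K ⊗[R] F) :
    symmetrizeIncl k K ε w =
      K.subtype.rTensor F w + ε • tensorSwap k R F (K.subtype.rTensor F w) := rfl

theorem symmetrizeIncl_mem (K : Submodule R F) {ε : k} (hε : ε * ε = 1) (n : ℤ) (w : K ⊗[R] F)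
    (hw : w ∈ tensorGrading R (subGrading K ℱ) ℱ n) :
    symmetrizeIncl k K ε w ∈ swapGrading R ε ℱ n := by
  have := symmetrize_mem_swapGrading ℱ hε 1 (tensorGrading_map_mem (𝒩' := ℱ) K.subtype LinearMap.id
    (ℳ' := ℱ) (fun n x hx => hx) (fun n x hx => hx) n w hw)
  rwa [one_smul] at this

/-- Exactness at `(F ⊗ F)^ε`: the kernel of `f ⊗ f` is the sum of the images of `K ⊗ F` and `F ⊗ K`,
and averaging folds the second into the first. -/
theorem swapGrading_inf_ker_eq
    (𝒜 : ℤ → Submodule k R) [GradedAlgebra 𝒜] [SetLike.GradedSMul 𝒜 ℱ]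
    (f : F →ₗ[R] M) (hf : ∀ n, ∀ x ∈ ℱ n, f x ∈ ℳ n)
    (hs : Function.Surjective f) {ε : k} (hε : ε * ε = 1) (h2 : (2 : k) ≠ 0) (n : ℤ) :
    swapGrading R ε ℱ n ⊓ LinearMap.ker ((TensorProduct.map f f).restrictScalars k) =
      (tensorGrading R (subGrading (LinearMap.ker f) ℱ) ℱ n).map
        (symmetrizeIncl k (LinearMap.ker f) ε) := by
  let := (subGrading_isInternal ℱ (ker_gradedProj_mem f hf)).chooseDecomposition
  have := subGrading_gradedSMul 𝒜 (LinearMap.ker f) ℱ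
  let := (tensorGrading_isInternal ℱ ℱ 𝒜).chooseDecomposition
  let := (tensorGrading_isInternal (subGrading (LinearMap.ker f) ℱ) ℱ 𝒜).chooseDecomposition
  have hex := LinearMap.exact_subtype_ker_map f
  refine le_antisymm ?_ ?_
  · rintro z ⟨hz, hz0⟩
    have hz' := mem_swapGrading.1 hz
    refine exists_mem_of_mem_range (symmetrizeIncl k (LinearMap.ker f) ε)
      (fun n w hw => swapGrading_le ℱ ε n (symmetrizeIncl_mem _ hε n w hw)) hz'.1 ?_
    have hz1 : z ∈ LinearMap.ker (TensorProduct.map f f) := hz0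
    rw [TensorProduct.map_ker hex hs hex hs, Submodule.mem_sup] at hz1
    obtain ⟨_, ⟨b, rfl⟩, _, ⟨a, rfl⟩, rfl⟩ := hz1
    obtain ⟨b, rfl⟩ := (TensorProduct.comm R _ _).surjective b
    have hb : (LinearMap.ker f).subtype.lTensor F (TensorProduct.comm R _ _ b) =
        tensorSwap k R F ((LinearMap.ker f).subtype.rTensor F b) :=
      LinearMap.lTensor_comm _ b
    -- Here `z` is the image of `a` plus the exchanged image of `b`. Averaging `z` turns `b` into a
    -- contribution `ε • b` from `K ⊗ F`.
    refine ⟨(2⁻¹ : k) • (a + ε • b), ?_⟩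
    rw [← symmetrize_eq_self hε h2 hz'.2, map_smul, map_add, map_smul, symmetrizeIncl_apply,
      symmetrizeIncl_apply, hb, map_add, tensorSwap_tensorSwap, smul_add ε, smul_add ε, smul_smul ε,
      hε, one_smul]
    congr 1
    abel
  · rintro _ ⟨w, hw, rfl⟩
    refine ⟨symmetrizeIncl_mem _ hε n w hw, ?_⟩
    have h0 : TensorProduct.map f f ((LinearMap.ker f).subtype.rTensor F w) = 0 := by
      rw [← LinearMap.comp_apply, LinearMap.map_comp_rTensor, hex.linearMap_comp_eq_zero]
      simp
    rw [SetLike.mem_coe, LinearMap.mem_ker, LinearMap.restrictScalars_apply, symmetrizeIncl_apply, map_add,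
      map_restrictScalars_smul, ← tensorSwap_map, h0, map_zero, smul_zero, add_zero]

/-- Exactness at `K ⊗ F`. If `w` is killed, its image in `F ⊗ F` equals `-ε` times its own exchange,
so it also dies in `F ⊗ M`. By `hKM`, `w` dies in `K ⊗ M`, hence comes from some `v` in `K ⊗ K`.
Since `K ⊗ K` embeds in `F ⊗ F` by `hKK` and flatness, `v` is a `-ε`-eigenvector. -/
theorem tensorGrading_inf_ker_symmetrizeIncl_eq
    (𝒜 : ℤ → Submodule k R) [GradedAlgebra 𝒜] [SetLike.GradedSMul 𝒜 ℱ]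
    [Module.Flat R F] (f : F →ₗ[R] M)
    (hf : ∀ n, ∀ x ∈ ℱ n, f x ∈ ℳ n) (hs : Function.Surjective f)
    (hKM : Function.Injective ((LinearMap.ker f).subtype.rTensor M))
    (hKK : Function.Injective ((LinearMap.ker f).subtype.lTensor (LinearMap.ker f)))
    {ε : k} (hε : ε * ε = 1) (n : ℤ) :
    tensorGrading R (subGrading (LinearMap.ker f) ℱ) ℱ n ⊓
        LinearMap.ker (symmetrizeIncl k (LinearMap.ker f) ε) =
      (swapGrading R (-ε) (subGrading (LinearMap.ker f) ℱ) n).map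
        (((LinearMap.ker f).subtype.lTensor (LinearMap.ker f)).restrictScalars k) := by
  set K := LinearMap.ker f with hK
  let := (subGrading_isInternal ℱ (ker_gradedProj_mem f hf)).chooseDecomposition
  have := subGrading_gradedSMul 𝒜 K ℱ
  let := (tensorGrading_isInternal (subGrading K ℱ) ℱ 𝒜).chooseDecomposition
  let := (tensorGrading_isInternal (subGrading K ℱ) (subGrading K ℱ) 𝒜).chooseDecomposition
  have hex : Function.Exact K.subtype f := LinearMap.exact_subtype_ker_map f
  have hcomp : ∀ v : K ⊗[R] K, K.subtype.rTensor F (K.subtype.lTensor K v) =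
      TensorProduct.map K.subtype K.subtype v := fun v => by
    rw [← LinearMap.comp_apply, LinearMap.rTensor_comp_lTensor]
  have hmem : ∀ n, ∀ v ∈ tensorGrading R (subGrading K ℱ) (subGrading K ℱ) n,
      K.subtype.lTensor K v ∈ tensorGrading R (subGrading K ℱ) ℱ n :=
    tensorGrading_map_mem LinearMap.id K.subtype (fun n x hx => hx) (fun n x hx => hx)
  refine le_antisymm ?_ ?_
  · rintro w ⟨hw, hw0⟩
    have hw1 : K.subtype.rTensor F w + ε • tensorSwap k R F (K.subtype.rTensor F w) = 0 := hw0
    have hx : f.lTensor K w = 0 := by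
      apply hKM
      rw [map_zero, ← LinearMap.comp_apply, LinearMap.rTensor_comp_lTensor,
        ← LinearMap.lTensor_comp_rTensor, LinearMap.comp_apply, eq_neg_of_add_eq_zero_left hw1,
        map_neg, map_restrictScalars_smul, tensorSwap_apply, LinearMap.lTensor_comm, ← LinearMap.comp_apply,
        ← LinearMap.rTensor_comp, hex.linearMap_comp_eq_zero]
      simp
    obtain ⟨v, hv, rfl⟩ := exists_mem_of_mem_range (K.subtype.lTensor K) hmem hw
      ((lTensor_exact K hex hs w).1 hx)
    refine ⟨v, mem_swapGrading.2 ⟨hv, ?_⟩, rfl⟩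
    apply hKK
    apply Module.Flat.rTensor_preserves_injective_linearMap (M := F) K.subtype K.subtype_injective
    rw [hcomp] at hw1
    rw [hcomp, hcomp, ← tensorSwap_map, map_restrictScalars_smul]
    have := congr_arg (fun z => ε • z) hw1
    simp only [smul_add, smul_smul, hε, one_smul, smul_zero] at this
    rw [neg_smul]
    exact eq_neg_of_add_eq_zero_right this
  · rintro _ ⟨v, hv, rfl⟩
    have hv' := mem_swapGrading.1 hv
    refine ⟨hmem n v hv'.1, ?_⟩
    rw [SetLike.mem_coe, LinearMap.mem_ker, LinearMap.restrictScalars_apply, symmetrizeIncl_apply, hcomp,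
      tensorSwap_map, hv'.2, map_restrictScalars_smul, smul_smul, mul_neg, hε, neg_one_smul,
      add_neg_cancel]

/-- The Euler characteristic of the exact sequence
`0 → (K ⊗ K)^(-ε) → K ⊗ F → (F ⊗ F)^ε → (M ⊗ M)^ε → 0` in degree `n`. -/
theorem finrank_swapGrading_add
    (𝒜 : ℤ → Submodule k R) [GradedAlgebra 𝒜] [SetLike.GradedSMul 𝒜 ℱ] [SetLike.GradedSMul 𝒜 ℳ]
    [Module.Flat R F] (f : F →ₗ[R] M)
    (hf : ∀ n, ∀ x ∈ ℱ n, f x ∈ ℳ n) (hs : Function.Surjective f)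
    (hKM : Function.Injective ((LinearMap.ker f).subtype.rTensor M))
    (hKK : Function.Injective ((LinearMap.ker f).subtype.lTensor (LinearMap.ker f)))
    {ε : k} (hε : ε * ε = 1) (h2 : (2 : k) ≠ 0) (n : ℤ)
    [FiniteDimensional k (tensorGrading R ℱ ℱ n)]
    [FiniteDimensional k (tensorGrading R (subGrading (LinearMap.ker f) ℱ) ℱ n)] :
    Module.finrank k (swapGrading R ε ℳ n) +
        Module.finrank k (tensorGrading R (subGrading (LinearMap.ker f) ℱ) ℱ n) =
      Module.finrank k (swapGrading R ε ℱ n) +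
        Module.finrank k (swapGrading R (-ε) (subGrading (LinearMap.ker f) ℱ) n) := by
  have : FiniteDimensional k (swapGrading R ε ℱ n) :=
    Submodule.finiteDimensional_of_le (swapGrading_le ℱ ε n)
  have h1 := finrank_map_add_finrank_inf_ker ((TensorProduct.map f f).restrictScalars k)
    (swapGrading R ε ℱ n)
  have h3 := finrank_map_add_finrank_inf_ker (symmetrizeIncl k (LinearMap.ker f) ε)
    (tensorGrading R (subGrading (LinearMap.ker f) ℱ) ℱ n)
  rw [swapGrading_map_eq 𝒜 f hf hs hε h2, swapGrading_inf_ker_eq 𝒜 f hf hs hε h2] at h1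
  rw [tensorGrading_inf_ker_symmetrizeIncl_eq 𝒜 f hf hs hKM hKK hε,
    finrank_map_of_injOn _ _ fun v _ hv => (injective_iff_map_eq_zero _).1 hKK v hv] at h3
  omega

end SwapSequence

/-! ### Tensor products with free modules, and matrices -/

section FreeTensor

variable {k : Type*} {R M ι : Type u} [Field k] [CommRing R] [Algebra k R]
  [AddCommGroup M] [Module R M] [Module k M] [IsScalarTower k R M] [Fintype ι] [DecidableEq ι]

theorem tensorGrading_freeGrading_map (𝒜 : ℤ → Submodule k R) [GradedAlgebra 𝒜]
    (ℳ : ℤ → Submodule k M) [SetLike.GradedSMul 𝒜 ℳ] (d : ι → ℤ) (n : ℤ) :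
    (tensorGrading R ℳ (freeGrading 𝒜 d) n).map
        ((TensorProduct.piScalarRight R R M ι).toLinearMap.restrictScalars k) =
      Submodule.pi Set.univ fun j => ℳ (n - d j) := by
  refine le_antisymm ?_ fun v hv => ?_
  · rw [Submodule.map_le_iff_le_comap]
    refine tensorGrading_le fun i l hil x hx f hf => ?_
    rw [Submodule.mem_comap, Submodule.mem_pi]
    intro j _
    have := SetLike.GradedSMul.smul_mem (A := 𝒜) (B := ℳ) (mem_freeGrading.1 hf j) hx
    have hn : n - d j = (l - d j) +ᵥ i := by rw [vadd_eq_add]; omega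
    rw [hn]
    exact this
  · rw [Submodule.mem_pi] at hv
    refine ⟨∑ j, v j ⊗ₜ Pi.single j 1, sum_mem fun j _ => ?_, ?_⟩
    · have := tmul_mem_tensorGrading (R := R) (hv j trivial)
        (single_mem_freeGrading (𝒜 := 𝒜) (d := d) j SetLike.GradedOne.one_mem)
      simpa using this
    · funext l
      rw [map_sum, Finset.sum_apply, Finset.sum_eq_single l]
      · simp
      · intro j _ hj
        simp [hj.symm]
      · simp

theorem finrank_tensorGrading_freeGrading (𝒜 : ℤ → Submodule k R) [GradedAlgebra 𝒜]
    (ℳ : ℤ → Submodule k M) [SetLike.GradedSMul 𝒜 ℳ] [∀ n, FiniteDimensional k (ℳ n)]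
    (d : ι → ℤ) (n : ℤ) :
    Module.finrank k (tensorGrading R ℳ (freeGrading 𝒜 d) n) =
      ∑ j, Module.finrank k (ℳ (n - d j)) := by
  rw [← finrank_submodulePi, ← tensorGrading_freeGrading_map 𝒜 ℳ d n]
  exact (finrank_map_of_injOn _ _ fun v _ hv =>
    (LinearEquiv.map_eq_zero_iff (TensorProduct.piScalarRight R R M ι)).1 hv).symm

variable (k R ι) in
/-- The identification of `(ι → R) ⊗ (ι → R)` with square matrices. -/
def freeTensorEquiv : (ι → R) ⊗[R] (ι → R) →ₗ[k] ι → ι → R :=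
  (TensorProduct.piScalarRight R R (ι → R) ι).toLinearMap.restrictScalars k

theorem freeTensorEquiv_injective : Function.Injective (freeTensorEquiv k R ι) :=
  (TensorProduct.piScalarRight R R (ι → R) ι).injective

theorem freeTensorEquiv_swap (z : (ι → R) ⊗[R] (ι → R)) (l j : ι) :
    freeTensorEquiv k R ι (tensorSwap k R (ι → R) z) l j = freeTensorEquiv k R ι z j l := by
  induction z using TensorProduct.induction_on with
  | zero => simp
  | add x y hx hy => simp only [map_add, Pi.add_apply, hx, hy]
  | tmul x y =>
    change (TensorProduct.piScalarRight R R (ι → R) ι) (y ⊗ₜ x) l j =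
      (TensorProduct.piScalarRight R R (ι → R) ι) (x ⊗ₜ y) j l
    simp [mul_comm]

theorem mem_swapGrading_map (𝒜 : ℤ → Submodule k R) [GradedAlgebra 𝒜] (d : ι → ℤ) (ε : k) (n : ℤ)
    (v : ι → ι → R) : v ∈ (swapGrading R ε (freeGrading 𝒜 d) n).map (freeTensorEquiv k R ι) ↔
      (∀ l j, v l j ∈ 𝒜 (n - d l - d j)) ∧ ∀ l j, v j l = ε • v l j := by
  have := freeGrading_gradedSMul 𝒜 d
  have hmap := tensorGrading_freeGrading_map 𝒜 (freeGrading 𝒜 d) d n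
  have hmem : v ∈ (tensorGrading R (freeGrading 𝒜 d) (freeGrading 𝒜 d) n).map
      (freeTensorEquiv k R ι) ↔ ∀ l j, v l j ∈ 𝒜 (n - d l - d j) := by
    rw [freeTensorEquiv, hmap]
    simp [Submodule.mem_pi, mem_freeGrading]
  rw [← hmem]
  constructor
  · rintro ⟨z, hz, rfl⟩
    have hz' := mem_swapGrading.1 hz
    refine ⟨⟨z, hz'.1, rfl⟩, fun l j => ?_⟩
    rw [← freeTensorEquiv_swap, hz'.2, map_smul]
    rfl
  · rintro ⟨⟨z, hz, rfl⟩, h⟩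
    refine ⟨z, mem_swapGrading.2 ⟨hz, freeTensorEquiv_injective (k := k) ?_⟩, rfl⟩
    funext l j
    rw [freeTensorEquiv_swap, map_smul, h l j]
    rfl

/-- The symmetric matrices exceed the antisymmetric ones by the diagonal. -/
theorem finrank_swapGrading_freeGrading (h2 : (2 : k) ≠ 0) (𝒜 : ℤ → Submodule k R)
    [GradedAlgebra 𝒜] (d : ι → ℤ) [∀ n, FiniteDimensional k (𝒜 n)] (n : ℤ)
    [FiniteDimensional k (tensorGrading R (freeGrading 𝒜 d) (freeGrading 𝒜 d) n)] :
    Module.finrank k (swapGrading R (1 : k) (freeGrading 𝒜 d) n) =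
      Module.finrank k (swapGrading R (-1 : k) (freeGrading 𝒜 d) n) +
        ∑ j, Module.finrank k (𝒜 (n - 2 * d j)) := by
  -- An arbitrary order, used only to tell the two sides of the diagonal apart.
  let : LinearOrder ι := LinearOrder.lift' (Fintype.equivFin ι) (Fintype.equivFin ι).injective
  have : FiniteDimensional k (swapGrading R (1 : k) (freeGrading 𝒜 d) n) :=
    Submodule.finiteDimensional_of_le (swapGrading_le _ _ n)
  have hinj : ∀ A : Submodule k ((ι → R) ⊗[R] (ι → R)),
      Module.finrank k (A.map (freeTensorEquiv k R ι)) = Module.finrank k A := fun A =>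
    finrank_map_of_injOn _ _ fun v _ hv =>
      (injective_iff_map_eq_zero _).1 freeTensorEquiv_injective v hv
  rw [← hinj, ← hinj (swapGrading R (-1 : k) (freeGrading 𝒜 d) n)]
  have hU := mem_swapGrading_map 𝒜 d (1 : k) n
  have hV := mem_swapGrading_map 𝒜 d (-1 : k) n
  set U := (swapGrading R (1 : k) (freeGrading 𝒜 d) n).map (freeTensorEquiv k R ι)
  set V := (swapGrading R (-1 : k) (freeGrading 𝒜 d) n).map (freeTensorEquiv k R ι)
  let diag : (ι → ι → R) →ₗ[k] ι → R :=
    LinearMap.pi fun j => LinearMap.proj j ∘ₗ LinearMap.proj j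
  -- Changing signs on one side of the diagonal exchanges antisymmetric matrices with symmetric
  -- matrices of zero diagonal. The sign on the diagonal is immaterial, as those entries vanish.
  let s : ι → ι → k := fun l j => if l < j then 1 else -1
  let θ : (ι → ι → R) →ₗ[k] ι → ι → R :=
    { toFun := fun v l j => s l j • v l j
      map_add' := fun v w => by funext l j; exact smul_add _ _ _
      map_smul' := fun c v => by funext l j; exact smul_comm _ _ _ }
  have hθ : ∀ v l j, θ v l j = s l j • v l j := fun v l j => rfl
  have hs : ∀ l j, s l j * s l j = 1 := fun l j => by
    by_cases h : l < j <;> simp [s, h]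
  have hs' : ∀ l j, l ≠ j → s j l = -s l j := fun l j hlj => by
    rcases hlj.lt_or_gt with h | h <;> simp [s, h, h.not_gt]
  have hV0 : ∀ v ∈ V, ∀ l, v l l = 0 := fun v hv l => by
    have := ((hV v).1 hv).2 l l
    rw [neg_one_smul, eq_neg_iff_add_eq_zero, ← two_smul k] at this
    exact (smul_eq_zero_iff_right h2).1 this
  have hdiag : U.map diag = Submodule.pi Set.univ fun j => 𝒜 (n - 2 * d j) := by
    refine le_antisymm ?_ fun w hw => ?_
    · rintro _ ⟨v, hv, rfl⟩
      rw [Submodule.mem_pi]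
      intro j _
      have := ((hU v).1 hv).1 j j
      rwa [sub_sub, ← two_mul] at this
    · rw [Submodule.mem_pi] at hw
      refine ⟨fun l j => if l = j then w l else 0, (hU _).2 ⟨fun l j => ?_, fun l j => ?_⟩, ?_⟩
      · split_ifs with h
        · subst h
          rw [sub_sub, ← two_mul]
          exact hw l trivial
        · exact zero_mem _
      · rw [one_smul]
        by_cases h : l = j
        · subst h; rfl
        · simp [h, Ne.symm h]
      · funext l
        simp [diag]
  have hker : U ⊓ LinearMap.ker diag = V.map θ := by
    refine le_antisymm ?_ ?_
    · rintro v ⟨hv, hv0⟩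
      have hv' := (hU v).1 hv
      refine ⟨θ v, (hV _).2 ⟨fun l j => Submodule.smul_mem _ _ (hv'.1 l j), fun l j => ?_⟩, ?_⟩
      · rw [hθ, hθ]
        by_cases h : l = j
        · subst h
          have : v l l = 0 := congr_fun hv0 l
          simp [this]
        · rw [hs' l j h, hv'.2 l j, one_smul, neg_one_smul, neg_smul]
      · funext l j
        rw [hθ, hθ, smul_smul, hs, one_smul]
    · rintro _ ⟨v, hv, rfl⟩
      have hv' := (hV v).1 hv
      refine ⟨(hU _).2 ⟨fun l j => Submodule.smul_mem _ _ (hv'.1 l j), fun l j => ?_⟩, ?_⟩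
      · rw [hθ, hθ]
        by_cases h : l = j
        · subst h
          simp
        · rw [hs' l j h, hv'.2 l j, one_smul, neg_one_smul, neg_smul, smul_neg, neg_neg]
      · funext l
        change θ v l l = 0
        rw [hθ, hV0 v hv, smul_zero]
  have h := finrank_map_add_finrank_inf_ker diag U
  rw [hdiag, hker, finrank_submodulePi, finrank_map_of_injOn θ V fun v _ hv => ?_] at h
  · omega
  · funext l j
    have := congr_fun (congr_fun hv l) j
    rw [hθ] at this
    have h' := congr_arg (fun z => s l j • z) this
    simpa only [smul_smul, hs, one_smul, Pi.zero_apply, smul_zero] using h'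

theorem finrank_freeGrading (𝒜 : ℤ → Submodule k R) (d : ι → ℤ) [∀ n, FiniteDimensional k (𝒜 n)]
    (n : ℤ) : Module.finrank k (freeGrading 𝒜 d n) = ∑ j, Module.finrank k (𝒜 (n - d j)) :=
  finrank_submodulePi _

end FreeTensor

/-! ### Dimensions in the sequence of a graded cover -/

section ExactKernel

variable {k : Type*} {R F M : Type u} [Field k] [CommRing R] [Algebra k R]
  [AddCommGroup F] [Module R F] [Module k F] [IsScalarTower k R F]
  [AddCommGroup M] [Module R M] [Module k M] [IsScalarTower k R M]
  {ℱ : ℤ → Submodule k F} [DirectSum.Decomposition ℱ]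
  {ℳ : ℤ → Submodule k M} [DirectSum.Decomposition ℳ]

theorem finrank_add_finrank_ker (f : F →ₗ[R] M) (hf : ∀ n, ∀ x ∈ ℱ n, f x ∈ ℳ n)
    (hs : Function.Surjective f) (n : ℤ) [FiniteDimensional k (ℱ n)] :
    Module.finrank k (ℳ n) + Module.finrank k (subGrading (LinearMap.ker f) ℱ n) =
      Module.finrank k (ℱ n) := by
  have h := finrank_map_add_finrank_inf_ker (f.restrictScalars k) (ℱ n)
  have h1 : (ℱ n).map (f.restrictScalars k) = ℳ n := by
    refine le_antisymm ?_ fun x hx => exists_mem_of_mem_range f hf hx (hs x)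
    rintro _ ⟨x, hx, rfl⟩
    exact hf n x hx
  have h2 : ℱ n ⊓ LinearMap.ker (f.restrictScalars k) =
      (subGrading (LinearMap.ker f) ℱ n).map ((LinearMap.ker f).subtype.restrictScalars k) := by
    ext x
    constructor
    · rintro ⟨hx, hx0⟩
      exact ⟨⟨x, hx0⟩, hx, rfl⟩
    · rintro ⟨y, hy, rfl⟩
      exact ⟨hy, y.2⟩
  rwa [h1, h2, finrank_map_of_injOn _ _ fun v _ hv => Subtype.ext hv] at h

end ExactKernel

/-! ### Laurent series and the substitution of the square -/

section Laurent

theorem LaurentSeries.coeff_mul_eq_zero {f g : LaurentSeries ℚ} {a b : ℤ}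
    (hf : ∀ i < a, f.coeff i = 0) (hg : ∀ i < b, g.coeff i = 0) :
    ∀ n < a + b, (f * g).coeff n = 0 := by
  intro n hn
  rw [HahnSeries.coeff_mul]
  refine Finset.sum_eq_zero fun ij hij => ?_
  have h := (Finset.mem_antidiagonal.1 hij).2.2
  rcases lt_or_ge ij.1 a with h1 | h1
  · rw [hf _ h1, zero_mul]
  · rw [hg ij.2 (by omega), mul_zero]

theorem substSq_coeff_two_mul (f : LaurentSeries ℚ) (n : ℤ) :
    (substSq f).coeff (2 * n) = f.coeff n :=
  HahnSeries.embDomain_coeff (f := ⟨⟨AddMonoidHom.mulLeft (2 : ℤ), fun a b h => by simpa using h⟩,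
    by simp⟩)

theorem substSq_coeff_eq_zero {f : LaurentSeries ℚ} {a : ℤ} (hf : ∀ i < a, f.coeff i = 0) :
    ∀ n < 2 * a, (substSq f).coeff n = 0 := by
  intro n hn
  by_cases h : ∃ i, n = 2 * i
  · obtain ⟨i, rfl⟩ := h
    rw [substSq_coeff_two_mul, hf i (by omega)]
  · refine HahnSeries.embDomain_of_notMem_range ?_
    rintro ⟨i, hi⟩
    exact h ⟨i, hi.symm⟩

theorem substSq_single (a : ℤ) (r : ℚ) :
    substSq (HahnSeries.single a r) = HahnSeries.single (2 * a) r :=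
  HahnSeries.embDomain_single

end Laurent

/-! ### Coefficients and comparison of Hilbert series -/

section HilbertSeries

variable {k V W : Type*} [Field k] [AddCommGroup V] [Module k V] [AddCommGroup W] [Module k W]

theorem HasHilbertSeries.coeff {𝒱 : ℤ → Submodule k V} (h : HasHilbertSeries 𝒱) (n : ℤ) :
    (hilbertSeries 𝒱).coeff n = Module.finrank k (𝒱 n) := by
  have hb : BddBelow (Function.support fun i : ℤ => (Module.finrank k (𝒱 i) : ℚ)) := by
    refine h.bddBelow.mono fun i hi => show 𝒱 i ≠ ⊥ from fun h0 => hi ?_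
    change (Module.finrank k (𝒱 i) : ℚ) = 0
    rw [h0, finrank_bot, Nat.cast_zero]
  rw [hilbertSeries, dif_pos hb, HahnSeries.coeff_ofSuppBddBelow]

theorem HasHilbertSeries.coeff_eq_zero {𝒱 : ℤ → Submodule k V} (h : HasHilbertSeries 𝒱) {m : ℤ}
    (hm : ∀ i < m, 𝒱 i = ⊥) : ∀ i < m, (hilbertSeries 𝒱).coeff i = 0 := by
  intro i hi
  rw [h.coeff, hm i hi]
  simp

theorem HasHilbertSeries.exists_bound {𝒱 : ℤ → Submodule k V} (h : HasHilbertSeries 𝒱) :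
    ∃ m, ∀ i < m, 𝒱 i = ⊥ := by
  obtain ⟨m, hm⟩ := h.bddBelow
  exact ⟨m, fun i hi => by_contra fun h => absurd (hm h) (not_le.2 hi)⟩

theorem HasHilbertSeries.mono {𝒱 𝒲 : ℤ → Submodule k V} (h : HasHilbertSeries 𝒱)
    (hle : ∀ n, 𝒲 n ≤ 𝒱 n) : HasHilbertSeries 𝒲 where
  finite n := by
    have := h.finite n
    exact Submodule.finiteDimensional_of_le (hle n)
  bddBelow := h.bddBelow.mono fun n hn => show 𝒱 n ≠ ⊥ from fun h0 =>
    hn (eq_bot_iff.2 (h0 ▸ hle n))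

theorem HasHilbertSeries.map {𝒱 : ℤ → Submodule k V} (h : HasHilbertSeries 𝒱) (f : V →ₗ[k] W) :
    HasHilbertSeries fun n => (𝒱 n).map f where
  finite n := by
    have := h.finite n
    infer_instance
  bddBelow := h.bddBelow.mono fun n hn => show 𝒱 n ≠ ⊥ from fun h0 => hn (by simp [h0])

theorem hilbertSeries_congr {𝒱 : ℤ → Submodule k V} {𝒲 : ℤ → Submodule k W}
    (h : ∀ n, Module.finrank k (𝒱 n) = Module.finrank k (𝒲 n)) :
    hilbertSeries 𝒱 = hilbertSeries 𝒲 := by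
  have : (fun i => (Module.finrank k (𝒱 i) : ℚ)) = fun i => (Module.finrank k (𝒲 i) : ℚ) := by
    simp only [h]
  unfold hilbertSeries
  congr!

end HilbertSeries

/-! ### The two defects and their vanishing -/

section Defects

variable {k : Type*} {R M : Type u} [Field k] [CommRing R] [Algebra k R]
  [AddCommGroup M] [Module R M] [Module k M] [IsScalarTower k R M]

/-- The failure of `H_{M ⊗ M} = H_M(t)² / H_R(t)`. -/
noncomputable def tensorDefect (𝒜 : ℤ → Submodule k R) (ℳ : ℤ → Submodule k M) :
    LaurentSeries ℚ :=
  hilbertSeries 𝒜 * (hilbertSeries (swapGrading R (1 : k) ℳ) +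
    hilbertSeries (swapGrading R (-1 : k) ℳ)) - hilbertSeries ℳ * hilbertSeries ℳ

/-- The failure of `H_{S² M} - H_{⋀² M} = H_R(t) H_M(t²) / H_R(t²)`. -/
noncomputable def traceDefect (𝒜 : ℤ → Submodule k R) (ℳ : ℤ → Submodule k M) :
    LaurentSeries ℚ :=
  substSq (hilbertSeries 𝒜) * (hilbertSeries (swapGrading R (1 : k) ℳ) -
    hilbertSeries (swapGrading R (-1 : k) ℳ)) - hilbertSeries 𝒜 * substSq (hilbertSeries ℳ)

variable {𝒜 : ℤ → Submodule k R} [GradedAlgebra 𝒜] [IsNoetherianRing R] [Module.Finite R M]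
  {ℳ : ℤ → Submodule k M} [DirectSum.Decomposition ℳ] [SetLike.GradedSMul 𝒜 ℳ]

theorem IsPositivelyGraded.hasHilbertSeries_swapGrading (h𝒜 : IsPositivelyGraded 𝒜) (ε : k) :
    HasHilbertSeries (swapGrading R ε ℳ) :=
  (h𝒜.hasHilbertSeries_tensor (ℳ := ℳ) (𝒩 := ℳ)).mono fun n => swapGrading_le ℳ ε n

theorem defects_coeff_eq_zero (h𝒜 : IsPositivelyGraded 𝒜) {m : ℤ} (hm : ∀ i < m, ℳ i = ⊥) (n : ℤ)
    (hn : n < 2 * m) : (tensorDefect 𝒜 ℳ).coeff n = 0 ∧ (traceDefect 𝒜 ℳ).coeff n = 0 := by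
  have hR := (h𝒜.hasHilbertSeries 𝒜).coeff_eq_zero h𝒜.eq_bot_of_neg
  have hM := (h𝒜.hasHilbertSeries_module ℳ).coeff_eq_zero hm
  have hT : ∀ ε : k, ∀ i < 2 * m, (hilbertSeries (swapGrading R ε ℳ)).coeff i = 0 := fun ε =>
    (h𝒜.hasHilbertSeries_swapGrading ε).coeff_eq_zero fun i hi =>
      eq_bot_iff.2 ((swapGrading_le ℳ ε i).trans_eq (tensorGrading_eq_bot hm hm (by omega)))
  constructor
  · rw [tensorDefect, HahnSeries.coeff_sub,
      LaurentSeries.coeff_mul_eq_zero hR (b := 2 * m) (fun i hi => ?_) n (by omega),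
      LaurentSeries.coeff_mul_eq_zero hM hM n (by omega), sub_zero]
    rw [HahnSeries.coeff_add, hT _ i hi, hT _ i hi, add_zero]
  · rw [traceDefect, HahnSeries.coeff_sub,
      LaurentSeries.coeff_mul_eq_zero (substSq_coeff_eq_zero hR) (b := 2 * m) (fun i hi => ?_) n
        (by omega),
      LaurentSeries.coeff_mul_eq_zero hR (substSq_coeff_eq_zero hM) n (by omega), sub_zero]
    rw [HahnSeries.coeff_sub, hT _ i hi, hT _ i hi, sub_zero]

/-- The effect of passing to a syzygy on the two defects. -/
theorem defects_ker (h𝒜 : IsPositivelyGraded 𝒜) (h2 : (2 : k) ≠ 0) {ι : Type u} [Fintype ι]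
    {d : ι → ℤ} (f : (ι → R) →ₗ[R] M) (hf : ∀ n, ∀ x ∈ freeGrading 𝒜 d n, f x ∈ ℳ n)
    (hs : Function.Surjective f) (hTor : TorIndep R M M) :
    tensorDefect 𝒜 ℳ = tensorDefect 𝒜 (subGrading (LinearMap.ker f) (freeGrading 𝒜 d)) ∧
      traceDefect 𝒜 ℳ = -traceDefect 𝒜 (subGrading (LinearMap.ker f) (freeGrading 𝒜 d)) := by
  classical
  have hKM := hTor.injective_rTensor f hs
  -- This is the vanishing of `Tor₁(M, K)`, which is `Tor₂(M, M)` after a dimension shift.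
  have hKK := (hTor.ker f hs).symm.injective_rTensor f hs
  rw [← LinearMap.lTensor_inj_iff_rTensor_inj] at hKK
  let := (freeGrading_isInternal 𝒜 d).chooseDecomposition
  have := freeGrading_gradedSMul 𝒜 d
  let := (subGrading_isInternal (freeGrading 𝒜 d) (ker_gradedProj_mem f hf)).chooseDecomposition
  have := subGrading_gradedSMul 𝒜 (LinearMap.ker f) (freeGrading 𝒜 d)
  set 𝒦 := subGrading (LinearMap.ker f) (freeGrading 𝒜 d)
  have hR := h𝒜.hasHilbertSeries 𝒜
  have hM := h𝒜.hasHilbertSeries_module ℳ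
  have hF := h𝒜.hasHilbertSeries_module (freeGrading 𝒜 d)
  have hK := h𝒜.hasHilbertSeries_module 𝒦
  have hFF := h𝒜.hasHilbertSeries_tensor (ℳ := freeGrading 𝒜 d) (𝒩 := freeGrading 𝒜 d)
  have hKF := h𝒜.hasHilbertSeries_tensor (ℳ := 𝒦) (𝒩 := freeGrading 𝒜 d)
  have hTM := fun ε => h𝒜.hasHilbertSeries_swapGrading (ℳ := ℳ) ε
  have hTF := fun ε => h𝒜.hasHilbertSeries_swapGrading (ℳ := freeGrading 𝒜 d) ε
  have hTK := fun ε => h𝒜.hasHilbertSeries_swapGrading (ℳ := 𝒦) ε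
  have := hR.finite
  have := hF.finite
  have := hK.finite
  have := hFF.finite
  have := hKF.finite
  -- The generating polynomial of the degrees of the basis of `F`: tensoring with `F` multiplies
  -- series by `P`, and the diagonal of `F ⊗ F` contributes `P(t²) H_R(t)`.
  let P : LaurentSeries ℚ := ∑ j, HahnSeries.single (d j) 1
  have hP : ∀ (Q : LaurentSeries ℚ) n, (P * Q).coeff n = ∑ j, Q.coeff (n - d j) := fun Q n => by
    simp only [P, Finset.sum_mul, HahnSeries.coeff_sum, HahnSeries.coeff_single_mul, one_mul]
  have hP2 : ∀ (Q : LaurentSeries ℚ) n,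
      (substSq P * Q).coeff n = ∑ j, Q.coeff (n - 2 * d j) := fun Q n => by
    simp only [P, map_sum, substSq_single, Finset.sum_mul, HahnSeries.coeff_sum,
      HahnSeries.coeff_single_mul, one_mul]
  have eF : hilbertSeries (freeGrading 𝒜 d) = P * hilbertSeries 𝒜 := by
    ext n
    rw [hP, hF.coeff, finrank_freeGrading]
    simp [hR.coeff]
  have eM : hilbertSeries ℳ + hilbertSeries 𝒦 = hilbertSeries (freeGrading 𝒜 d) := by
    ext n
    rw [HahnSeries.coeff_add, hF.coeff, hM.coeff, hK.coeff]
    exact_mod_cast finrank_add_finrank_ker f hf hs n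
  have eKF : hilbertSeries (tensorGrading R 𝒦 (freeGrading 𝒜 d)) = P * hilbertSeries 𝒦 := by
    ext n
    rw [hP, hKF.coeff, finrank_tensorGrading_freeGrading]
    simp [hK.coeff]
  have eFF : hilbertSeries (swapGrading R (1 : k) (freeGrading 𝒜 d)) +
      hilbertSeries (swapGrading R (-1 : k) (freeGrading 𝒜 d)) =
        P * hilbertSeries (freeGrading 𝒜 d) := by
    ext n
    rw [hP, HahnSeries.coeff_add, (hTF _).coeff, (hTF _).coeff]
    simp only [hF.coeff]
    have := finrank_tensorGrading_eq (R := R) (freeGrading 𝒜 d) h2 n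
    rw [finrank_tensorGrading_freeGrading] at this
    exact_mod_cast this.symm
  have eFd : hilbertSeries (swapGrading R (1 : k) (freeGrading 𝒜 d)) =
      hilbertSeries (swapGrading R (-1 : k) (freeGrading 𝒜 d)) +
        substSq P * hilbertSeries 𝒜 := by
    ext n
    rw [HahnSeries.coeff_add, hP2, (hTF _).coeff, (hTF _).coeff]
    simp only [hR.coeff]
    exact_mod_cast finrank_swapGrading_freeGrading h2 𝒜 d n
  have eS : ∀ ε : k, ε * ε = 1 → hilbertSeries (swapGrading R ε ℳ) + P * hilbertSeries 𝒦 =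
      hilbertSeries (swapGrading R ε (freeGrading 𝒜 d)) + hilbertSeries (swapGrading R (-ε) 𝒦) := by
    intro ε hε
    ext n
    rw [← eKF, HahnSeries.coeff_add, HahnSeries.coeff_add, (hTM _).coeff, (hTF _).coeff,
      (hTK _).coeff, hKF.coeff]
    exact_mod_cast finrank_swapGrading_add 𝒜 f hf hs hKM hKK hε h2 n
  have e1 := eS 1 (by simp)
  have e2 := eS (-1) (by simp)
  rw [neg_neg] at e2
  rw [eF] at eM eFF
  have eM2 := congr_arg substSq eM
  rw [map_add, map_mul] at eM2
  rw [tensorDefect, tensorDefect, traceDefect, traceDefect]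
  constructor
  · linear_combination hilbertSeries 𝒜 * (e1 + e2 + eFF) -
      (hilbertSeries ℳ - hilbertSeries 𝒦 + P * hilbertSeries 𝒜) * eM
  · linear_combination substSq (hilbertSeries 𝒜) * (e1 - e2 + eFd) - hilbertSeries 𝒜 * eM2

theorem defects_eq_zero (h𝒜 : IsPositivelyGraded 𝒜) (h2 : (2 : k) ≠ 0)
    (hTor : TorIndep R M M) : tensorDefect 𝒜 ℳ = 0 ∧ traceDefect 𝒜 ℳ = 0 := by
  -- The module and its lower bound `m` vary in the induction, because each step replaces `M` by a
  -- syzygy.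
  have key : ∀ (e : ℕ) (M : Type u) [AddCommGroup M] [Module R M] [Module k M]
      [IsScalarTower k R M] [Module.Finite R M] (ℳ : ℤ → Submodule k M)
      [DirectSum.Decomposition ℳ] [SetLike.GradedSMul 𝒜 ℳ] (m : ℤ), (∀ i < m, ℳ i = ⊥) →
      TorIndep R M M → ∀ n < 2 * m + e,
        (tensorDefect 𝒜 ℳ).coeff n = 0 ∧ (traceDefect 𝒜 ℳ).coeff n = 0 := by
    intro e
    induction e with
    | zero =>
      intro M _ _ _ _ _ ℳ _ _ m hm _ n hn
      exact defects_coeff_eq_zero h𝒜 hm n (by simpa using hn)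
    | succ e ih =>
      intro M _ _ _ _ _ ℳ _ _ m hm hTor n hn
      obtain ⟨ι, _, d, y, hy, hd, hs, hmin⟩ := exists_free_cover ℳ h𝒜 m hm
      set f := Fintype.linearCombination R y
      have hf : ∀ n, ∀ x ∈ freeGrading 𝒜 d n, f x ∈ ℳ n := linearCombination_mem hy
      obtain ⟨h1, h2'⟩ := defects_ker h𝒜 h2 f hf hs hTor
      let := (freeGrading_isInternal 𝒜 d).chooseDecomposition
      have := freeGrading_gradedSMul 𝒜 d
      let := (subGrading_isInternal (freeGrading 𝒜 d)
        (ker_gradedProj_mem f hf)).chooseDecomposition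
      have := subGrading_gradedSMul 𝒜 (LinearMap.ker f) (freeGrading 𝒜 d)
      have hbot : ∀ i < m + 1, subGrading (LinearMap.ker f) (freeGrading 𝒜 d) i = ⊥ := by
        intro i hi
        rw [eq_bot_iff]
        intro x hx
        rw [mem_subGrading] at hx
        rcases (Int.lt_add_one_iff.1 hi).lt_or_eq with h | rfl
        · rw [freeGrading_eq_bot h𝒜 fun j => h.trans_le (hd j)] at hx
          exact Subtype.ext hx
        · exact Subtype.ext (hmin x hx x.2)
      -- Raising `m` by 1 raises `2 * m` by 2, more than the one degree needed. Shifting in each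
      -- variable in turn gives the Tor-independence of `K` with itself.
      have := ih (LinearMap.ker f) (subGrading (LinearMap.ker f) (freeGrading 𝒜 d)) (m + 1) hbot
        ((hTor.ker f hs).symm.ker f hs) n (by push_cast at hn; omega)
      rw [h1, h2', HahnSeries.coeff_neg, this.1, this.2, neg_zero]
      exact ⟨rfl, rfl⟩
  obtain ⟨m, hm⟩ := (h𝒜.hasHilbertSeries_module ℳ).exists_bound
  have := fun n : ℤ => key (n + 1 - 2 * m).toNat M ℳ m hm hTor n (by omega)
  exact ⟨HahnSeries.ext (funext fun n => (this n).1), HahnSeries.ext (funext fun n => (this n).2)⟩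

end Defects

/-! ### Division by `H_R` and the final formulas -/

theorem IsPositivelyGraded.hilbertSeries_ne_zero {k R : Type*} [Field k] [CommRing R] [Algebra k R]
    {𝒜 : ℤ → Submodule k R} [GradedAlgebra 𝒜] (h𝒜 : IsPositivelyGraded 𝒜)
    (h : HasHilbertSeries 𝒜) : hilbertSeries 𝒜 ≠ 0 := by
  intro h0
  have hc := h.coeff 0
  have := h.finite 0
  rw [h0, HahnSeries.coeff_zero, eq_comm, Nat.cast_eq_zero, Submodule.finrank_eq_zero] at hc
  have h1 : (1 : R) ∈ 𝒜 0 := SetLike.GradedOne.one_mem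
  rw [hc, Submodule.mem_bot, ← map_one (algebraMap k R)] at h1
  exact one_ne_zero (h𝒜.injective_algebraMap (h1.trans (map_zero _).symm))

theorem lemma3p3 {k : Type*} {R M : Type u} [Field k] (hk : ringChar k ≠ 2)
    [CommRing R] [IsNoetherianRing R] [Algebra k R]
    (𝒜 : ℤ → Submodule k R) [GradedAlgebra 𝒜] (h𝒜 : IsPositivelyGraded 𝒜)
    [AddCommGroup M] [Module R M] [Module.Finite R M] [Module k M] [IsScalarTower k R M]
    (ℳ : ℤ → Submodule k M) [DirectSum.Decomposition ℳ] [SetLike.GradedSMul 𝒜 ℳ]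
    (hTor : ∀ i : ℕ, 0 < i →
      Limits.IsZero (((Tor (ModuleCat.{u} R) i).obj (ModuleCat.of R M)).obj (ModuleCat.of R M))) :
    HasHilbertSeries 𝒜 ∧ HasHilbertSeries ℳ ∧
    HasHilbertSeries (symSqGrading R ℳ) ∧ HasHilbertSeries (extSqGrading R ℳ) ∧
    hilbertSeries (symSqGrading R ℳ) =
      hilbertSeries ℳ ^ 2 / (2 * hilbertSeries 𝒜) +
        substSq (hilbertSeries ℳ) * hilbertSeries 𝒜 / (2 * substSq (hilbertSeries 𝒜)) ∧
    hilbertSeries (extSqGrading R ℳ) =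
      hilbertSeries ℳ ^ 2 / (2 * hilbertSeries 𝒜) -
        hilbertSeries 𝒜 * substSq (hilbertSeries ℳ) / (2 * substSq (hilbertSeries 𝒜)) := by
  have h2 : (2 : k) ≠ 0 := Ring.two_ne_zero hk
  have hR := h𝒜.hasHilbertSeries 𝒜
  have hT := h𝒜.hasHilbertSeries_tensor (ℳ := ℳ) (𝒩 := ℳ)
  refine ⟨hR, h𝒜.hasHilbertSeries_module ℳ, ?_, ?_, ?_⟩
  · rw [funext (symSqGrading_eq_map ℳ)]
    exact hT.map _
  · rw [funext (extSqGrading_eq_map ℳ)]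
    exact hT.map _
  · rw [hilbertSeries_congr (finrank_symSqGrading ℳ h2),
      hilbertSeries_congr (finrank_extSqGrading ℳ h2)]
    obtain ⟨h1, h3⟩ := defects_eq_zero (ℳ := ℳ) h𝒜 h2 (torIndep_of_isZero_tor M M hTor)
    rw [tensorDefect] at h1
    rw [traceDefect] at h3
    have hR0 := h𝒜.hilbertSeries_ne_zero hR
    have hR2 : substSq (hilbertSeries 𝒜) ≠ 0 := (map_ne_zero substSq).2 hR0
    have h20 : (2 : LaurentSeries ℚ) ≠ 0 := by
      rw [← map_ofNat (algebraMap ℚ (LaurentSeries ℚ)) 2]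
      exact (map_ne_zero _).2 two_ne_zero
    constructor
    · field_simp
      linear_combination substSq (hilbertSeries 𝒜) * h1 + hilbertSeries 𝒜 * h3
    · field_simp
      linear_combination substSq (hilbertSeries 𝒜) * h1 - hilbertSeries 𝒜 * h3
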